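/- For an open set $\Omega\subset\mathbb{C}$ and $1\le p<\infty$ let $A^p(\Omega)$ be the complex vector space of all holomorphic functions $f:\Omega\to\mathbb{C}$ with $\int_\Omega |f|^p\,d\lambda<\infty$ ($\lambda$ is planar Lebesgue measure), with the norm $\|f\|=\left(\int_\Omega|f|^p\,d\lambda\right)^{1/p}$. A domain is a non-empty connected open subset of $\mathbb{C}$. 1. For every $1\le p<2$ and every integer $k\ge 0$ there is a domain $\Omega_k\subset\mathbb{C}$ with $\dim_{\mathbb{C}} A^p(\Omega_k)=k$. 2. If $1<p<2$, $k\ge 0$ is an integer and $a_0,\dots,a_k\in\mathbb{C}$ are pairwise distinct, then $\Omega_k=\mathbb{C}\setminus\{a_0,\dots,a_k\}$ is a domain with $\dim_{\mathbb{C}} A^p(\Omega_k)=k$, and the functions $\frac{1}{z-a_0}-\frac{1}{z-a_j}$, $1\le j\le k$, form a basis of $A^p(\Omega_k)$. 3. If $2\le p<\infty$ and $\Omega\subset\mathbb{C}$ is a domain, then either $A^p(\Omega)=\{0\}$ or $A^p(\Omega)$ is an infinite dimensional Banach space. -/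

import Mathlib

open MeasureTheory TopologicalSpace
open scoped ENNReal

noncomputable section

/-- The extension by zero of a function on the open set `Ω` to the whole plane. -/
def zeroExt {Ω : Opens ℂ} (f : Ω → ℂ) : ℂ → ℂ :=
  Function.extend Subtype.val f 0

theorem zeroExt_apply {Ω : Opens ℂ} (f : Ω → ℂ) (z : Ω) : zeroExt f z = f z :=
  Subtype.val_injective.extend_apply f 0 z

theorem zeroExt_zero {Ω : Opens ℂ} : zeroExt (0 : Ω → ℂ) = 0 :=
  Function.extend_zero _

theorem zeroExt_add {Ω : Opens ℂ} (f g : Ω → ℂ) :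
    zeroExt (f + g) = zeroExt f + zeroExt g := by
  have h := Function.extend_add (Subtype.val : Ω → ℂ) f g 0 0
  rwa [add_zero] at h

theorem zeroExt_smul {Ω : Opens ℂ} (c : ℂ) (f : Ω → ℂ) :
    zeroExt (c • f) = c • zeroExt f := by
  have h := Function.extend_smul c (Subtype.val : Ω → ℂ) f 0
  rwa [smul_zero] at h

/-- The complex vector space of the functions `f : Ω → ℂ` that are holomorphic on `Ω` and
`p`-integrable on `Ω` with respect to planar Lebesgue measure. -/
def bergmanSubmodule (p : ℝ≥0∞) (Ω : Opens ℂ) : Submodule ℂ (Ω → ℂ) where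
  carrier := {f | DifferentiableOn ℂ (zeroExt f) Ω ∧ MemLp (zeroExt f) p (volume.restrict Ω)}
  zero_mem' := by
    simp only [Set.mem_ofPred_eq, zeroExt_zero]
    exact ⟨differentiableOn_const 0, MemLp.zero⟩
  add_mem' := by
    rintro f g ⟨hf, hf'⟩ ⟨hg, hg'⟩
    simp only [Set.mem_ofPred_eq, zeroExt_add]
    exact ⟨hf.add hg, hf'.add hg'⟩
  smul_mem' := by
    rintro c f ⟨hf, hf'⟩
    simp only [Set.mem_ofPred_eq, zeroExt_smul]
    exact ⟨hf.const_smul c, hf'.const_smul c⟩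

/-- The `p`-Bergman space `A^p(Ω)`. It is a type of its own, so that it carries the `L^p` norm
and not the topology of pointwise convergence of the ambient space of functions. -/
def BergmanSpace (p : ℝ≥0∞) (Ω : Opens ℂ) : Type := bergmanSubmodule p Ω

namespace BergmanSpace

variable {p : ℝ≥0∞} {Ω : Opens ℂ}

instance : AddCommGroup (BergmanSpace p Ω) :=
  inferInstanceAs (AddCommGroup (bergmanSubmodule p Ω))

instance : Module ℂ (BergmanSpace p Ω) :=
  inferInstanceAs (Module ℂ (bergmanSubmodule p Ω))

/-- The function on `Ω` underlying an element of the Bergman space. -/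
def toFun (f : BergmanSpace p Ω) : Ω → ℂ := Subtype.val f

instance : CoeFun (BergmanSpace p Ω) (fun _ => Ω → ℂ) := ⟨toFun⟩

theorem memLp (f : BergmanSpace p Ω) : MemLp (zeroExt f) p (volume.restrict Ω) := f.2.2

/-- The inclusion of `A^p(Ω)` into `L^p(Ω)`. -/
def toLp : BergmanSpace p Ω →ₗ[ℂ] Lp ℂ p (volume.restrict (Ω : Set ℂ)) where
  toFun f := (memLp f).toLp _
  map_add' f g := by
    rw [← MemLp.toLp_add]
    exact MemLp.toLp_congr _ _ (Filter.EventuallyEq.of_eq (zeroExt_add f.toFun g.toFun))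
  map_smul' c f := by
    rw [RingHom.id_apply, ← MemLp.toLp_const_smul]
    exact MemLp.toLp_congr _ _ (Filter.EventuallyEq.of_eq (zeroExt_smul c f.toFun))

theorem toLp_injective : Function.Injective (toLp : BergmanSpace p Ω →ₗ[ℂ] _) := by
  intro f g h
  have h' := (MemLp.toLp_eq_toLp_iff (memLp f) (memLp g)).1 h
  have h'' : Set.EqOn (zeroExt f) (zeroExt g) Ω :=
    Measure.eqOn_open_of_ae_eq h' Ω.isOpen f.2.1.continuousOn g.2.1.continuousOn
  refine Subtype.ext (funext fun z => ?_)
  have hz := h'' z.2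
  rwa [zeroExt_apply, zeroExt_apply] at hz

/-- `A^p(Ω)` is normed by the `L^p` norm on `Ω`. -/
instance [Fact (1 ≤ p)] : NormedAddCommGroup (BergmanSpace p Ω) :=
  NormedAddCommGroup.induced _ _ (toLp : BergmanSpace p Ω →ₗ[ℂ] _) toLp_injective

instance [Fact (1 ≤ p)] : NormedSpace ℂ (BergmanSpace p Ω) :=
  NormedSpace.induced ℂ _ _ (toLp : BergmanSpace p Ω →ₗ[ℂ] _)

theorem norm_def [Fact (1 ≤ p)] (f : BergmanSpace p Ω) :
    ‖f‖ = (eLpNorm (zeroExt f) p (volume.restrict Ω)).toReal :=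
  Lp.norm_toLp _ (memLp f)

end BergmanSpace

/-- The open set `ℂ ∖ {a 0, …, a k}`. -/
def puncturedPlane {k : ℕ} (a : Fin (k + 1) → ℂ) : Opens ℂ :=
  ⟨(Set.range a)ᶜ, (Set.finite_range a).isClosed.isOpen_compl⟩

end

open Metric Filter Asymptotics Topology Set

/-! Everything rests on the estimate `|f c| r^(2/p) ≤ ‖f‖` for `f` holomorphic on the disc of centre
`c` and radius `r`, with the `L^p` norm over that disc. It comes from the area mean value property
and Hölder's inequality.

If `f` is in `L^p` and holomorphic off a finite set, the norm over small or far discs tends to zero,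
so `f` is `o(|z - a|^(-2/p))` at each point `a` and `o(|z|^(-2/p))` at infinity. As `2/p ≤ 2`, the
singularities are at most simple poles, and Liouville's theorem leaves `f = ∑ c_j / (z - a_j)`
(`exists_eq_sum_inv_sub_of_memLp`). For `1 < p < 2` such a sum is in `L^p` exactly when `∑ c_j = 0`;
for `p = 1` one also needs `∑ c_j a_j = 0`. Hence `k + 1` punctures, or `k + 2` when `p = 1`, give
dimension `k`. For `p ≥ 2` no simple pole is locally in `L^p`, and `f` vanishes.

For `p ≥ 2` suppose that `A^p(Ω)` is nonzero and finite dimensional. If the complement of `Ω` has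
positive area, there is a nonconstant bounded holomorphic function on `Ω`: the coordinate when `Ω`
is bounded, otherwise the Cauchy transform of a compact part of the complement. Multiplication by it
has an eigenvector, which forces it to be constant. If the complement is null, the quotients `(f z -
f c_i) / (z - c_i)`, combined so that `∑ α_i f(c_i) = 0`, stay in `A^p(Ω)`. Enough points `c_i`
yield a linear relation, which solves to `f = A / B` with polynomials `A`, `B`. This rational
function is in `L^p` of the plane, hence zero. Completeness is the usual passage from `L^p`
convergence to locally uniform convergence. -/

/-! ### Mean values and pointwise bounds by the `L^p` norm -/

theorem lintegral_eq_lintegral_circleMap {g : ℂ → ℝ≥0∞} (hg : Measurable g) :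
    ∫⁻ w, g w = ∫⁻ ρ in Ioi (0 : ℝ), ENNReal.ofReal ρ *
      ∫⁻ θ in Ioo (-Real.pi) Real.pi, g (circleMap 0 ρ θ) := by
  have hm : Measurable fun q : ℝ × ℝ => ENNReal.ofReal q.1 * g (circleMap 0 q.1 q.2) := by
    refine (by fun_prop : Measurable fun q : ℝ × ℝ => ENNReal.ofReal q.1).mul (hg.comp ?_)
    unfold circleMap
    fun_prop
  have h1 : ∫⁻ w, g w = ∫⁻ q in Ioi (0 : ℝ) ×ˢ Ioo (-Real.pi) Real.pi,
      ENNReal.ofReal q.1 * g (circleMap 0 q.1 q.2) := by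
    rw [← Complex.lintegral_comp_polarCoord_symm]
    refine lintegral_congr fun q => ?_
    rw [Complex.polarCoord_symm_apply, circleMap_zero, smul_eq_mul]
    congr 3
    push_cast
    rw [Complex.exp_mul_I]
  rw [h1, Measure.volume_eq_prod, setLIntegral_prod _ hm.aemeasurable]
  refine lintegral_congr fun ρ => ?_
  rw [← lintegral_const_mul']
  exact ENNReal.ofReal_ne_top

/-- Triangle inequality in Cauchy's mean value formula. The angle runs over `(-π, π)` to match polar
coordinates. -/
theorem DiffContOnCl.enorm_mul_le_lintegral_circleMap {f : ℂ → ℂ} {c : ℂ} {ρ : ℝ} (hρ : 0 < ρ)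
    (hf : DiffContOnCl ℂ f (ball c ρ)) :
    ‖f c‖ₑ * volume (Ioo (-Real.pi) Real.pi) ≤
      ∫⁻ θ in Ioo (-Real.pi) Real.pi, ‖f (circleMap c ρ θ)‖ₑ := by
  have h := DiffContOnCl.circleAverage (R := ρ) (by rwa [abs_of_pos hρ])
  rw [Real.circleAverage_eq_integral_add (-Real.pi),
    intervalIntegral.integral_comp_add_right (fun θ => f (circleMap c ρ θ)),
    show (0 : ℝ) + -Real.pi = -Real.pi by ring,
    show 2 * Real.pi + -Real.pi = Real.pi by ring,
    intervalIntegral.integral_of_le (by linarith [Real.pi_pos]),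
    integral_Ioc_eq_integral_Ioo] at h
  have hpi : (2 * Real.pi) ≠ 0 := by positivity
  have h' : ∫ θ in Ioo (-Real.pi) Real.pi, f (circleMap c ρ θ) = (2 * Real.pi) • f c := by
    rw [← h, smul_smul, mul_inv_cancel₀ hpi, one_smul]
  calc ‖f c‖ₑ * volume (Ioo (-Real.pi) Real.pi) = ‖(2 * Real.pi) • f c‖ₑ := by
        rw [enorm_smul, Real.volume_Ioo, mul_comm, Real.enorm_of_nonneg (by positivity)]
        congr 2
        ring
    _ ≤ _ := by
        rw [← h']
        exact enorm_integral_le_lintegral_enorm _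

/-- The area sub-mean value property of holomorphic functions on a disc. -/
theorem DifferentiableOn.enorm_mul_volume_ball_le {f : ℂ → ℂ} {c : ℂ} {r : ℝ}
    (hf : DifferentiableOn ℂ f (ball c r)) :
    ‖f c‖ₑ * volume (ball c r) ≤ ∫⁻ w in ball c r, ‖f w‖ₑ := by
  classical
  set F : ℂ → ℂ := (ball c r).indicator f with hF
  have hFm : Measurable F := by
    rw [hF, ← Set.piecewise_eq_indicator]
    exact hf.continuousOn.measurable_piecewise continuousOn_const measurableSet_ball
  have hleft : ‖f c‖ₑ * volume (ball c r) =
      ∫⁻ w, (ball (0 : ℂ) r).indicator (fun _ => ‖f c‖ₑ) w := by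
    rw [lintegral_indicator_const measurableSet_ball, Complex.volume_ball, Complex.volume_ball]
  have hright : ∫⁻ w in ball c r, ‖f w‖ₑ = ∫⁻ w, ‖F (c + w)‖ₑ := by
    rw [lintegral_add_left_eq_self (fun w => ‖F w‖ₑ), ← lintegral_indicator measurableSet_ball]
    simp only [hF, enorm_indicator_eq_indicator_enorm]
  rw [hleft, hright, lintegral_eq_lintegral_circleMap (measurable_const.indicator measurableSet_ball),
    lintegral_eq_lintegral_circleMap (by fun_prop)]
  refine setLIntegral_mono' measurableSet_Ioi fun ρ (hρ : 0 < ρ) => ?_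
  gcongr ENNReal.ofReal ρ * ?_
  have hmap (θ : ℝ) : c + circleMap 0 ρ θ = circleMap c ρ θ := by simp [circleMap]
  simp only [hmap]
  by_cases hr : ρ < r
  · have hin (θ : ℝ) : circleMap c ρ θ ∈ ball c r := by
      simp [circleMap, abs_of_pos hρ, hr]
    have hin0 (θ : ℝ) : circleMap 0 ρ θ ∈ ball (0 : ℂ) r := by
      simp [circleMap, abs_of_pos hρ, hr]
    simp only [hF, indicator_of_mem (hin _), indicator_of_mem (hin0 _), lintegral_const,
      Measure.restrict_apply_univ]
    exact (hf.diffContOnCl_ball (closedBall_subset_ball hr)).enorm_mul_le_lintegral_circleMap hρ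
  · have hin0 (θ : ℝ) : circleMap 0 ρ θ ∉ ball (0 : ℂ) r := by
      simpa [circleMap, abs_of_pos hρ] using hr
    simp [indicator_of_notMem (hin0 _)]

/-- Pointwise bound of a holomorphic function by its `L^p` norm on a disc. -/
theorem DifferentiableOn.enorm_mul_rpow_le_eLpNorm {f : ℂ → ℂ} {c : ℂ} {r : ℝ} (hr : 0 < r)
    {p : ℝ≥0∞} (hp1 : 1 ≤ p) (hp : p ≠ ∞) (hf : DifferentiableOn ℂ f (ball c r)) :
    ‖f c‖ₑ * ENNReal.ofReal (r ^ (2 / p.toReal)) ≤ eLpNorm f p (volume.restrict (ball c r)) := by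
  have hp0 : 0 < p.toReal := ENNReal.toReal_pos (by positivity) hp
  set v := volume (ball c r) with hv
  have hv0 : v ≠ 0 := (measure_ball_pos volume c hr).ne'
  have hvt : v ≠ ∞ := measure_ball_lt_top.ne
  have hm : AEStronglyMeasurable f (volume.restrict (ball c r)) :=
    hf.continuousOn.aestronglyMeasurable measurableSet_ball
  -- Hölder against the constant 1 costs `v ^ (1 - 1/p)`, which then cancels against part of the
  -- factor `v` on the left.
  have h1 : ‖f c‖ₑ * v ≤ eLpNorm f p (volume.restrict (ball c r)) * v ^ (1 - 1 / p.toReal) := by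
    refine hf.enorm_mul_volume_ball_le.trans ?_
    have := eLpNorm_le_eLpNorm_mul_rpow_measure_univ hp1 hm
    simpa only [eLpNorm_one_eq_lintegral_enorm, ENNReal.toReal_one, div_one,
      Measure.restrict_apply_univ] using this
  have h2 : v = v ^ (1 / p.toReal) * v ^ (1 - 1 / p.toReal) := by
    rw [← ENNReal.rpow_add _ _ hv0 hvt]
    simp
  have h3 : ‖f c‖ₑ * v ^ (1 / p.toReal) ≤ eLpNorm f p (volume.restrict (ball c r)) := by
    rw [h2, ← mul_assoc] at h1
    rw [← h2] at h1
    refine (ENNReal.mul_le_mul_iff_left ?_ ?_).1 h1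
    · exact (ENNReal.rpow_pos (pos_iff_ne_zero.2 hv0) hvt).ne'
    · exact ENNReal.rpow_ne_top_of_ne_zero hv0 hvt
  refine le_trans ?_ h3
  gcongr
  -- The area `π r²` is weakened to `r²`, so that no constant appears in the bound.
  have h4 : ENNReal.ofReal (r ^ (2 : ℝ)) ≤ v := by
    rw [hv, Complex.volume_ball]
    have : ENNReal.ofReal (r ^ (2 : ℝ)) = ENNReal.ofReal r ^ 2 * 1 := by
      rw [mul_one, ← ENNReal.ofReal_pow hr.le]
      norm_cast
    rw [this]
    gcongr
    have : (1 : NNReal) ≤ NNReal.pi := by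
      have := Real.pi_gt_three
      rw [← NNReal.coe_le_coe]
      simp only [NNReal.coe_one, NNReal.coe_real_pi]
      linarith
    exact_mod_cast this
  calc ENNReal.ofReal (r ^ (2 / p.toReal)) = ENNReal.ofReal (r ^ (2 : ℝ)) ^ (1 / p.toReal) := by
        rw [ENNReal.ofReal_rpow_of_nonneg (by positivity) (by positivity), ← Real.rpow_mul hr.le]
        congr 2
        ring
    _ ≤ v ^ (1 / p.toReal) := by gcongr

theorem DifferentiableOn.norm_mul_rpow_le_of_eLpNorm_le {f : ℂ → ℂ} {c : ℂ} {r ε : ℝ} (hr : 0 < r)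
    (hε : 0 ≤ ε) {p : ℝ≥0∞} (hp1 : 1 ≤ p) (hp : p ≠ ∞) (hf : DifferentiableOn ℂ f (ball c r))
    (h : eLpNorm f p (volume.restrict (ball c r)) ≤ ENNReal.ofReal ε) :
    ‖f c‖ ≤ ε * r ^ (-(2 / p.toReal)) := by
  have h1 := (hf.enorm_mul_rpow_le_eLpNorm hr hp1 hp).trans h
  rw [← ofReal_norm, ← ENNReal.ofReal_mul (norm_nonneg _),
    ENNReal.ofReal_le_ofReal_iff hε] at h1
  rw [Real.rpow_neg hr.le, ← div_eq_mul_inv, le_div_iff₀ (by positivity)]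
  exact h1

/-! ### Growth at isolated singularities and at infinity -/

section IsolatedSingularities

variable {f : ℂ → ℂ} {S : Set ℂ} {p : ℝ≥0∞}

/-- The pointwise bound is applied on the disc about `z` of radius `|z - a|`. Its area tends to zero
as `z → a`, so by absolute continuity of the integral the norm of `f` over it does too. -/
theorem isLittleO_nhdsNE_of_memLp (hS : S.Finite) (hp1 : 1 ≤ p) (hp : p ≠ ∞)
    (hf : DifferentiableOn ℂ f Sᶜ) (hfp : MemLp f p volume) (a : ℂ) :
    f =o[𝓝[≠] a] fun z => ‖z - a‖ ^ (-(2 / p.toReal)) := by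
  refine isLittleO_iff.2 fun ε hε => ?_
  obtain ⟨δ, hδ, hδf⟩ := hfp.eLpNorm_indicator_le hp1 hp hε
  -- Only the points of `S` other than `a` need to be kept away: the open disc about `z` of radius
  -- `|z - a|` misses `a` itself.
  obtain ⟨d, hd, hdS⟩ := Metric.mem_nhds_iff.1
    ((hS.subset (sdiff_subset (t := {a}))).isClosed.isOpen_compl.mem_nhds
      (show a ∈ (S \ {a})ᶜ by simp))
  have hvol : ∀ᶠ z in 𝓝[≠] a, volume (ball z ‖z - a‖) ≤ ENNReal.ofReal δ := by
    simp only [Complex.volume_ball]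
    have : Tendsto (fun z => ENNReal.ofReal ‖z - a‖ ^ 2 * (NNReal.pi : ℝ≥0∞)) (𝓝 a) (𝓝 0) := by
      have h0 : Tendsto (fun z => ENNReal.ofReal ‖z - a‖) (𝓝 a) (𝓝 0) := by
        have := (ENNReal.continuous_ofReal.comp
          (by fun_prop : Continuous fun z : ℂ => ‖z - a‖)).tendsto a
        simpa only [Function.comp_def, sub_self, norm_zero, ENNReal.ofReal_zero] using this
      have h1 := ENNReal.Tendsto.mul_const (ENNReal.Tendsto.pow (n := 2) h0) (b := NNReal.pi)
        (Or.inr ENNReal.coe_ne_top)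
      simpa using h1
    exact nhdsWithin_le_nhds (this.eventually (eventually_le_nhds (by simpa using hδ)))
  have hball : ∀ᶠ z in 𝓝[≠] a, z ∈ ball a (d / 2) :=
    nhdsWithin_le_nhds (ball_mem_nhds a (by positivity))
  filter_upwards [hvol, hball, self_mem_nhdsWithin] with z hz hzd hza
  have hr : 0 < ‖z - a‖ := norm_pos_iff.2 (sub_ne_zero.2 hza)
  have hsub : ball z ‖z - a‖ ⊆ Sᶜ := by
    intro w hw hwS
    have hwa : w ≠ a := by
      rintro rfl
      simp [dist_eq_norm, norm_sub_rev] at hw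
    refine hdS (mem_ball.2 ?_) ⟨hwS, hwa⟩
    rw [mem_ball, dist_eq_norm] at hw hzd
    calc dist w a ≤ dist w z + dist z a := dist_triangle _ _ _
      _ < d := by rw [dist_eq_norm, dist_eq_norm]; linarith
  have h1 := hδf _ measurableSet_ball hz
  rw [eLpNorm_indicator_eq_eLpNorm_restrict measurableSet_ball] at h1
  have h2 := (hf.mono hsub).norm_mul_rpow_le_of_eLpNorm_le hr hε.le hp1 hp h1
  rwa [Real.norm_of_nonneg (by positivity)]

/-- The pointwise bound is applied on the disc about `z` of radius `|z| / 2`. For large `z` it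
misses the support of a compactly supported approximation of `f` in `L^p`, so the norm of `f` over
it is at most the approximation error. -/
theorem isLittleO_cobounded_of_memLp (hS : S.Finite) (hp1 : 1 ≤ p) (hp : p ≠ ∞)
    (hf : DifferentiableOn ℂ f Sᶜ) (hfp : MemLp f p volume) :
    f =o[Bornology.cobounded ℂ] fun z => ‖z‖ ^ (-(2 / p.toReal)) := by
  have hp0 : 0 < p.toReal := ENNReal.toReal_pos (by positivity) hp
  suffices h : f =o[Bornology.cobounded ℂ] fun z => (‖z‖ / 2) ^ (-(2 / p.toReal)) by
    refine h.trans_isBigO (IsBigO.of_bound ((2 : ℝ)⁻¹ ^ (-(2 / p.toReal)))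
      (Eventually.of_forall fun z => ?_))
    rw [div_eq_mul_inv, Real.mul_rpow (norm_nonneg _) (by norm_num), norm_mul, mul_comm,
      Real.norm_of_nonneg (by positivity : (0:ℝ) ≤ 2⁻¹ ^ (-(2 / p.toReal)))]
  refine isLittleO_iff.2 fun ε hε => ?_
  obtain ⟨g, hgc, hgf, -, -⟩ := hfp.exists_hasCompactSupport_eLpNorm_sub_le hp
    (ε := ENNReal.ofReal ε) (by simpa using hε)
  obtain ⟨M, hM, hMs⟩ := (hS.isBounded.union hgc.isCompact.isBounded).subset_ball_lt 0 0
  have hlarge : ∀ᶠ z in Bornology.cobounded ℂ, 2 * M ≤ ‖z‖ :=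
    tendsto_norm_cobounded_atTop.eventually_ge_atTop _
  filter_upwards [hlarge] with z hz
  have hr : 0 < ‖z‖ / 2 := by linarith
  have hfar : ∀ w ∈ ball z (‖z‖ / 2), w ∉ S ∪ tsupport g := by
    intro w hw hwS
    have h1 := hMs hwS
    rw [mem_ball, dist_eq_norm] at hw
    rw [mem_ball_zero_iff] at h1
    have := norm_sub_norm_le z w
    rw [norm_sub_rev] at this
    linarith
  have hsub : ball z (‖z‖ / 2) ⊆ Sᶜ := fun w hw hwS => hfar w hw (Or.inl hwS)
  have h1 : eLpNorm f p (volume.restrict (ball z (‖z‖ / 2))) ≤ ENNReal.ofReal ε := by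
    calc _ = eLpNorm (f - g) p (volume.restrict (ball z (‖z‖ / 2))) := by
          refine eLpNorm_congr_ae ((ae_restrict_iff' measurableSet_ball).2
            (Eventually.of_forall fun w hw => ?_))
          have : g w = 0 := image_eq_zero_of_notMem_tsupport fun h => hfar w hw (Or.inr h)
          simp [this]
      _ ≤ eLpNorm (f - g) p volume := eLpNorm_mono_measure _ Measure.restrict_le_self
      _ ≤ _ := hgf
  have h2 := (hf.mono hsub).norm_mul_rpow_le_of_eLpNorm_le hr hε.le hp1 hp h1
  rwa [Real.norm_of_nonneg (by positivity)]

end IsolatedSingularities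

/-! ### Partial fractions and expansions at infinity -/

section SimplePoles

theorem tendsto_inv_sub_cobounded (a : ℂ) :
    Tendsto (fun z : ℂ => (z - a)⁻¹) (Bornology.cobounded ℂ) (𝓝 0) :=
  tendsto_inv₀_cobounded.comp (tendsto_sub_const_cobounded a)

theorem tendsto_mul_inv_sub_cobounded (a : ℂ) :
    Tendsto (fun z : ℂ => z * (z - a)⁻¹) (Bornology.cobounded ℂ) (𝓝 1) := by
  have h : Tendsto (fun z : ℂ => 1 + a * (z - a)⁻¹) (Bornology.cobounded ℂ) (𝓝 (1 + a * 0)) :=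
    tendsto_const_nhds.add ((tendsto_inv_sub_cobounded a).const_mul a)
  rw [mul_zero, add_zero] at h
  refine h.congr' ?_
  filter_upwards [Bornology.eventually_ne_cobounded a] with z hz
  field_simp [sub_ne_zero.2 hz]
  ring

/-- A function with finitely many singularities that are at most simple poles is the sum of its
principal parts and an entire function. -/
theorem exists_eq_add_sum_inv_sub_of_isLittleO (S : Finset ℂ) {f : ℂ → ℂ}
    (hf : DifferentiableOn ℂ f (S : Set ℂ)ᶜ)
    (hS : ∀ a ∈ S, (fun z => (z - a) * f z) =o[𝓝[≠] a] fun z => (z - a)⁻¹) :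
    ∃ (c : ℂ → ℂ) (g : ℂ → ℂ), Differentiable ℂ g ∧
      ∀ z ∉ S, f z = g z + ∑ a ∈ S, c a * (z - a)⁻¹ := by
  classical
  induction S using Finset.induction_on generalizing f with
  | empty => exact ⟨0, f, differentiableOn_univ.1 (by simpa using hf), by simp⟩
  | insert a S ha ih =>
    have hnhds : ((S : Set ℂ)ᶜ) ∈ 𝓝 a := S.finite_toSet.isClosed.isOpen_compl.mem_nhds ha
    -- This is `(z - a) f` with its removable singularity filled in. Its value at `a` is the
    -- residue, and its divided difference at `a` is `f` without the principal part there, to which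
    -- the induction hypothesis applies.
    set h : ℂ → ℂ := Function.update (fun z => (z - a) * f z) a
      (limUnder (𝓝[≠] a) fun z => (z - a) * f z) with hh
    have hd : DifferentiableOn ℂ h (S : Set ℂ)ᶜ := by
      refine Complex.differentiableOn_update_limUnder_of_isLittleO hnhds ?_ ?_
      · refine DifferentiableOn.mul (by fun_prop) (hf.mono fun z hz => ?_)
        simpa [and_comm] using hz
      · simpa using hS a (Finset.mem_insert_self a S)
    have hne : ∀ z, z ≠ a → dslope h a z = f z - h a * (z - a)⁻¹ := by
      intro z hz
      have h1 : h z = (z - a) * f z := by rw [hh, Function.update_of_ne hz]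
      rw [dslope_of_ne _ hz, slope_def_field, h1]
      field_simp [sub_ne_zero.2 hz]
    obtain ⟨c, g, hg, hc⟩ := ih (f := dslope h a) ((Complex.differentiableOn_dslope hnhds).2 hd) (by
      intro b hb
      have hba : b ≠ a := fun h => ha (h ▸ hb)
      have h1 := hS b (Finset.mem_insert_of_mem hb)
      have h2 : (fun z => (z - b) * (h a * (z - a)⁻¹)) =o[𝓝[≠] b] fun z => (z - b)⁻¹ := by
        have h3 : Tendsto (fun z => (z - b) * (h a * (z - a)⁻¹)) (𝓝[≠] b)
            (𝓝 ((b - b) * (h a * (b - a)⁻¹))) := by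
          refine Tendsto.mono_left (ContinuousAt.tendsto ?_) nhdsWithin_le_nhds
          have : b - a ≠ 0 := sub_ne_zero.2 hba
          fun_prop (disch := assumption)
        refine (h3.isBigO_one ℝ).trans_isLittleO ?_
        refine (isLittleO_one_left_iff ℝ).2 ?_
        have h4 : Tendsto (fun z : ℂ => z - b) (𝓝[≠] b) (𝓝[≠] 0) := by
          refine tendsto_nhdsWithin_iff.2 ⟨?_, ?_⟩
          · have : Tendsto (fun z : ℂ => z - b) (𝓝 b) (𝓝 (b - b)) :=
              (by fun_prop : Continuous fun z : ℂ => z - b).tendsto b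
            rw [sub_self] at this
            exact this.mono_left nhdsWithin_le_nhds
          · filter_upwards [self_mem_nhdsWithin] with z hz
            exact sub_ne_zero.2 hz
        exact tendsto_norm_cobounded_atTop.comp (tendsto_inv₀_nhdsNE_zero.comp h4)
      refine (h1.sub h2).congr' ?_ EventuallyEq.rfl
      filter_upwards [nhdsWithin_le_nhds (isOpen_ne.mem_nhds hba)] with z hz
      rw [hne z hz]
      ring)
    refine ⟨Function.update c a (h a), g, hg, fun z hz => ?_⟩
    rw [Finset.mem_insert, not_or] at hz
    rw [Finset.sum_insert ha, Function.update_self]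
    have h1 : ∑ b ∈ S, Function.update c a (h a) b * (z - b)⁻¹ = ∑ b ∈ S, c b * (z - b)⁻¹ :=
      Finset.sum_congr rfl fun b hb => by
        rw [Function.update_of_ne fun h : b = a => ha (h ▸ hb)]
    have h2 := hc z hz.2
    rw [hne z hz.1] at h2
    rw [h1]
    linear_combination h2

theorem tendsto_sub_mul_sum_inv_sub {ι : Type*} (s : Finset ι) {a : ι → ℂ}
    (ha : Function.Injective a) (c : ι → ℂ) {i : ι} (hi : i ∈ s) :
    Tendsto (fun z => (z - a i) * ∑ j ∈ s, c j * (z - a j)⁻¹) (𝓝[≠] (a i)) (𝓝 (c i)) := by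
  classical
  have h : Tendsto (fun z => c i + (z - a i) * ∑ j ∈ s.erase i, c j * (z - a j)⁻¹) (𝓝[≠] (a i))
      (𝓝 (c i + (a i - a i) * ∑ j ∈ s.erase i, c j * (a i - a j)⁻¹)) := by
    refine Tendsto.mono_left ?_ nhdsWithin_le_nhds
    refine tendsto_const_nhds.add (Tendsto.mul (Continuous.tendsto (by fun_prop) (a i))
      (tendsto_finsetSum _ fun j hj => ?_))
    have : a i - a j ≠ 0 := sub_ne_zero.2 (ha.ne (Finset.ne_of_mem_erase hj).symm)
    exact ContinuousAt.tendsto (by fun_prop (disch := assumption))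
  rw [sub_self, zero_mul, add_zero] at h
  refine h.congr' ?_
  filter_upwards [self_mem_nhdsWithin] with z hz
  have : z - a i ≠ 0 := sub_ne_zero.2 hz
  rw [← Finset.add_sum_erase s _ hi]
  field_simp

variable {p : ℝ≥0∞} {f : ℂ → ℂ} {S : Finset ℂ}

/-- An `L^p` function that is holomorphic off a finite set is a sum of simple poles. -/
theorem exists_eq_sum_inv_sub_of_memLp (hp1 : 1 ≤ p) (hp : p ≠ ∞)
    (hf : DifferentiableOn ℂ f (S : Set ℂ)ᶜ) (hfp : MemLp f p volume) :
    ∃ c : ℂ → ℂ, ∀ z ∉ S, f z = ∑ a ∈ S, c a * (z - a)⁻¹ := by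
  have hq1 : 1 ≤ p.toReal := by simpa using ENNReal.toReal_mono hp hp1
  have hq : 2 / p.toReal ≤ 2 := div_le_self (by norm_num) hq1
  obtain ⟨c, g, hg, hc⟩ := exists_eq_add_sum_inv_sub_of_isLittleO S hf (by
    intro a _
    have h1 := isLittleO_nhdsNE_of_memLp S.finite_toSet hp1 hp hf hfp a
    have h2 : f =o[𝓝[≠] a] fun z => (z - a)⁻¹ * (z - a)⁻¹ := by
      refine h1.trans_isBigO (IsBigO.of_bound 1 ?_)
      filter_upwards [self_mem_nhdsWithin, nhdsWithin_le_nhds (ball_mem_nhds a one_pos)] with z hz hz1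
      have h0 : 0 < ‖z - a‖ := norm_pos_iff.2 (sub_ne_zero.2 hz)
      rw [mem_ball, dist_eq_norm] at hz1
      rw [Real.norm_of_nonneg (by positivity), one_mul, ← mul_inv, norm_inv, norm_mul, ← sq,
        Real.rpow_neg h0.le]
      refine inv_anti₀ (by positivity) ?_
      rw [← Real.rpow_natCast]
      exact Real.rpow_le_rpow_of_exponent_ge h0 hz1.le (by simpa using hq)
    have h3 := (isBigO_refl (fun z => z - a) (𝓝[≠] a)).mul_isLittleO h2
    refine h3.congr' EventuallyEq.rfl ?_
    filter_upwards [self_mem_nhdsWithin] with z hz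
    have : z - a ≠ 0 := sub_ne_zero.2 hz
    field_simp)
  refine ⟨c, fun z hz => ?_⟩
  -- Both `f` and the pole sum vanish at infinity, hence so does the entire part, which is zero by
  -- Liouville.
  have hf0 : Tendsto f (Bornology.cobounded ℂ) (𝓝 0) := by
    refine (isLittleO_cobounded_of_memLp S.finite_toSet hp1 hp hf hfp).isBigO.trans_tendsto ?_
    exact (tendsto_rpow_neg_atTop (by positivity)).comp tendsto_norm_cobounded_atTop
  have hs0 : Tendsto (fun z => ∑ a ∈ S, c a * (z - a)⁻¹) (Bornology.cobounded ℂ) (𝓝 0) := by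
    simpa using tendsto_finsetSum S fun a _ => (tendsto_inv_sub_cobounded a).const_mul (c a)
  have hg0 : Tendsto g (cocompact ℂ) (𝓝 0) := by
    rw [← cobounded_eq_cocompact]
    have h := hf0.sub hs0
    rw [sub_zero] at h
    refine h.congr' ?_
    filter_upwards [S.finite_toSet.isBounded] with z hz
    rw [hc z hz]
    ring
  rw [hc z hz, hg.apply_eq_of_tendsto_cocompact z hg0, zero_add]

/-- Here `2/p ≥ 1`, so the decay at infinity beats `1/z`. This forces the residues to sum to zero.
-/
theorem tendsto_mul_of_memLp (hp1 : 1 ≤ p) (hp2 : p ≤ 2)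
    (hf : DifferentiableOn ℂ f (S : Set ℂ)ᶜ) (hfp : MemLp f p volume) :
    Tendsto (fun z => z * f z) (Bornology.cobounded ℂ) (𝓝 0) := by
  have hp : p ≠ ∞ := ne_top_of_le_ne_top (by norm_num) hp2
  have hq1 : 1 ≤ p.toReal := by simpa using ENNReal.toReal_mono hp hp1
  have hq2 : p.toReal ≤ 2 := by simpa using ENNReal.toReal_mono (by norm_num) hp2
  have hq : 1 ≤ 2 / p.toReal := by rwa [le_div_iff₀ (by positivity), one_mul]
  have h1 := isLittleO_cobounded_of_memLp S.finite_toSet hp1 hp hf hfp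
  have h2 : f =o[Bornology.cobounded ℂ] fun z => z⁻¹ := by
    refine h1.trans_isBigO (IsBigO.of_bound 1 ?_)
    filter_upwards [tendsto_norm_cobounded_atTop.eventually_ge_atTop 1] with z hz
    rw [Real.norm_of_nonneg (by positivity), one_mul, norm_inv, ← Real.rpow_neg_one]
    exact Real.rpow_le_rpow_of_exponent_le hz (by linarith)
  have h3 := (isBigO_refl (fun z : ℂ => z) (Bornology.cobounded ℂ)).mul_isLittleO h2
  refine (isLittleO_one_iff ℝ).1 (h3.trans_isBigO (IsBigO.of_bound 1 (Eventually.of_forall fun z => ?_)))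
  by_cases hz : z = 0 <;> simp [hz]

/-- For `p = 1` the decay exponent `2/p` is exactly 2. This yields the second relation, on the first
moment of the residues. -/
theorem tendsto_sq_mul_of_memLp_one
    (hf : DifferentiableOn ℂ f (S : Set ℂ)ᶜ) (hfp : MemLp f 1 volume) :
    Tendsto (fun z => z ^ 2 * f z) (Bornology.cobounded ℂ) (𝓝 0) := by
  have h1 := isLittleO_cobounded_of_memLp S.finite_toSet le_rfl ENNReal.one_ne_top hf hfp
  have h2 : f =o[Bornology.cobounded ℂ] fun z => (z ^ 2)⁻¹ := by
    refine h1.trans_isBigO (IsBigO.of_bound 1 (Eventually.of_forall fun z => ?_))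
    simp only [ENNReal.toReal_one, div_one, norm_inv, Real.rpow_neg (norm_nonneg z)]
    norm_cast
    simp
  have h3 := (isBigO_refl (fun z : ℂ => z ^ 2) (Bornology.cobounded ℂ)).mul_isLittleO h2
  refine (isLittleO_one_iff ℝ).1 (h3.trans_isBigO (IsBigO.of_bound 1 (Eventually.of_forall fun z => ?_)))
  by_cases hz : z = 0 <;> simp [hz]

theorem tendsto_mul_sum_inv_sub {ι : Type*} (s : Finset ι) (a c : ι → ℂ) :
    Tendsto (fun z => z * ∑ j ∈ s, c j * (z - a j)⁻¹) (Bornology.cobounded ℂ)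
      (𝓝 (∑ j ∈ s, c j)) := by
  have h := tendsto_finsetSum s fun j _ => (tendsto_mul_inv_sub_cobounded (a j)).const_mul (c j)
  simp only [mul_one] at h
  refine h.congr fun z => ?_
  rw [Finset.mul_sum]
  exact Finset.sum_congr rfl fun j _ => by ring

/-- Since `z / (z - a) = 1 + a / (z - a)`, multiplying by `z` replaces each coefficient `c_j` by
`c_j a_j` once the constants cancel. Iteration gives the successive orders of decay at infinity. -/
theorem eventually_mul_sum_inv_sub {ι : Type*} (s : Finset ι) (a c : ι → ℂ)
    (hc : ∑ j ∈ s, c j = 0) :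
    ∀ᶠ z in Bornology.cobounded ℂ, z * ∑ j ∈ s, c j * (z - a j)⁻¹ =
      ∑ j ∈ s, c j * a j * (z - a j)⁻¹ := by
  filter_upwards [(s.finite_toSet.image a).isBounded] with z hz
  have h : z * ∑ j ∈ s, c j * (z - a j)⁻¹ =
      ∑ j ∈ s, c j * a j * (z - a j)⁻¹ + ∑ j ∈ s, c j := by
    rw [← Finset.sum_add_distrib, Finset.mul_sum]
    refine Finset.sum_congr rfl fun j hj => ?_
    have : z - a j ≠ 0 := sub_ne_zero.2 fun h => hz ⟨j, hj, h.symm⟩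
    field_simp
    ring
  rw [h, hc, add_zero]

theorem tendsto_sq_mul_sum_inv_sub {ι : Type*} (s : Finset ι) (a c : ι → ℂ)
    (hc : ∑ j ∈ s, c j = 0) :
    Tendsto (fun z => z ^ 2 * ∑ j ∈ s, c j * (z - a j)⁻¹) (Bornology.cobounded ℂ)
      (𝓝 (∑ j ∈ s, c j * a j)) := by
  refine (tendsto_mul_sum_inv_sub s a fun j => c j * a j).congr' ?_
  filter_upwards [eventually_mul_sum_inv_sub s a c hc] with z hz
  rw [pow_two, mul_assoc, hz]

theorem tendsto_cube_mul_sum_inv_sub {ι : Type*} (s : Finset ι) (a c : ι → ℂ)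
    (hc : ∑ j ∈ s, c j = 0) (hca : ∑ j ∈ s, c j * a j = 0) :
    Tendsto (fun z => z ^ 3 * ∑ j ∈ s, c j * (z - a j)⁻¹) (Bornology.cobounded ℂ)
      (𝓝 (∑ j ∈ s, c j * a j * a j)) := by
  refine (tendsto_sq_mul_sum_inv_sub s a (fun j => c j * a j) hca).congr' ?_
  filter_upwards [eventually_mul_sum_inv_sub s a c hc] with z hz
  rw [← hz]
  ring

/-- For `p ≥ 2`, the only `L^p` function that is holomorphic off a finite set is zero. -/
theorem eq_zero_of_memLp_of_two_le (hp2 : 2 ≤ p) (hp : p ≠ ∞)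
    (hf : DifferentiableOn ℂ f (S : Set ℂ)ᶜ) (hfp : MemLp f p volume) :
    ∀ z ∉ S, f z = 0 := by
  have hp1 : 1 ≤ p := le_trans (by norm_num) hp2
  have hq2 : 2 ≤ p.toReal := by simpa using ENNReal.toReal_mono hp hp2
  have hq : 2 / p.toReal ≤ 1 := by rwa [div_le_one (by positivity)]
  obtain ⟨c, hc⟩ := exists_eq_sum_inv_sub_of_memLp hp1 hp hf hfp
  have hca : ∀ a ∈ S, c a = 0 := by
    intro a ha
    -- Now `2/p ≤ 1`, so `f` is `o(1/|z - a|)` and the residue, as the limit of `(z - a) f`, is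
    -- zero.
    have h1 := isLittleO_nhdsNE_of_memLp S.finite_toSet hp1 hp hf hfp a
    have h2 : f =o[𝓝[≠] a] fun z => (z - a)⁻¹ := by
      refine h1.trans_isBigO (IsBigO.of_bound 1 ?_)
      filter_upwards [self_mem_nhdsWithin, nhdsWithin_le_nhds (ball_mem_nhds a one_pos)] with z hz hz1
      have h0 : 0 < ‖z - a‖ := norm_pos_iff.2 (sub_ne_zero.2 hz)
      rw [mem_ball, dist_eq_norm] at hz1
      rw [Real.norm_of_nonneg (by positivity), one_mul, norm_inv, Real.rpow_neg h0.le]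
      refine inv_anti₀ (by positivity) ?_
      simpa using Real.rpow_le_rpow_of_exponent_ge h0 hz1.le hq
    have h3 := (isBigO_refl (fun z => z - a) (𝓝[≠] a)).mul_isLittleO h2
    have h4 : Tendsto (fun z => (z - a) * f z) (𝓝[≠] a) (𝓝 0) := by
      refine (isLittleO_one_iff ℝ).1
        (h3.trans_isBigO (IsBigO.of_bound 1 (Eventually.of_forall fun z => ?_)))
      by_cases hz : z - a = 0 <;> simp [hz]
    have hS : ∀ᶠ z in 𝓝[≠] a, z ∉ S := by
      have : ((S : Set ℂ) \ {a})ᶜ ∈ 𝓝 a :=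
        (S.finite_toSet.subset sdiff_subset).isClosed.isOpen_compl.mem_nhds (by simp)
      filter_upwards [nhdsWithin_le_nhds this, self_mem_nhdsWithin] with z hz hza hzS
      exact hz ⟨hzS, hza⟩
    refine tendsto_nhds_unique ((tendsto_sub_mul_sum_inv_sub S Function.injective_id c ha).congr' ?_) h4
    filter_upwards [hS] with z hz
    rw [hc z hz]
    rfl
  intro z hz
  rw [hc z hz]
  exact Finset.sum_eq_zero fun a ha => by rw [hca a ha, zero_mul]

end SimplePoles

/-! ### Integrability criteria -/

section Membership

variable {p : ℝ≥0∞}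

/-- Allows membership to be checked on an explicit formula on the plane instead of the extension by
zero. -/
theorem mem_bergmanSubmodule_iff {Ω : Opens ℂ} {f : Ω → ℂ} {F : ℂ → ℂ} (h : ∀ z : Ω, f z = F z) :
    f ∈ bergmanSubmodule p Ω ↔
      DifferentiableOn ℂ F Ω ∧ MemLp F p (volume.restrict (Ω : Set ℂ)) := by
  have he : EqOn (zeroExt f) F Ω := fun z hz => by
    rw [← h ⟨z, hz⟩, ← zeroExt_apply f ⟨z, hz⟩]
  have h1 : DifferentiableOn ℂ (zeroExt f) Ω ↔ DifferentiableOn ℂ F Ω := differentiableOn_congr he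
  have h2 : MemLp (zeroExt f) p (volume.restrict (Ω : Set ℂ)) ↔
      MemLp F p (volume.restrict (Ω : Set ℂ)) :=
    memLp_congr_ae ((ae_restrict_iff' Ω.isOpen.measurableSet).2 (Eventually.of_forall he))
  rw [← h1, ← h2]
  rfl

theorem MeasureTheory.MemLp.of_restrict_inter {g : ℂ → ℂ} {T U : Set ℂ} (hU : MeasurableSet U)
    (h1 : MemLp g p (volume.restrict (U ∩ T))) (h2 : MemLp g p (volume.restrict (Uᶜ ∩ T))) :
    MemLp g p (volume.restrict T) := by
  rw [← Measure.restrict_restrict hU, ← memLp_indicator_iff_restrict hU] at h1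
  rw [← Measure.restrict_restrict hU.compl, ← memLp_indicator_iff_restrict hU.compl] at h2
  simpa [indicator_self_add_compl] using h1.add h2

theorem memLp_one_add_norm_inv_pow (hp0 : p ≠ 0) (hp : p ≠ ∞) {n : ℕ} (hn : 2 < n * p.toReal) :
    MemLp (fun z : ℂ => ((1 + ‖z‖) ^ n)⁻¹) p volume := by
  have hc : Continuous fun z : ℂ => ((1 + ‖z‖) ^ n)⁻¹ := by
    have : ∀ z : ℂ, (1 + ‖z‖) ^ n ≠ 0 := fun z => by positivity
    fun_prop (disch := assumption)
  rw [← integrable_norm_rpow_iff hc.aestronglyMeasurable hp0 hp]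
  have h := integrable_one_add_norm (E := ℂ) (μ := volume) (r := n * p.toReal) (by simpa using hn)
  refine h.congr (Eventually.of_forall fun z => ?_)
  have h0 : (0 : ℝ) ≤ 1 + ‖z‖ := by positivity
  simp only
  rw [Real.norm_of_nonneg (by positivity), Real.rpow_neg h0, Real.inv_rpow (by positivity),
    Real.rpow_mul h0, Real.rpow_natCast]

/-- A locally `p`-integrable function that decays fast enough at infinity is `p`-integrable. -/
theorem memLp_restrict_of_isBigO_cobounded {g : ℂ → ℂ} {T : Set ℂ} (hp0 : p ≠ 0) (hp : p ≠ ∞)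
    {n : ℕ} (hn : 2 < n * p.toReal)
    (hO : (fun z => z ^ n * g z) =O[Bornology.cobounded ℂ] fun _ => (1 : ℝ))
    (hm : AEStronglyMeasurable g (volume.restrict T))
    (hloc : ∀ M, MemLp g p (volume.restrict (ball 0 M ∩ T))) :
    MemLp g p (volume.restrict T) := by
  obtain ⟨C, hC, hCg⟩ := hO.exists_pos
  obtain ⟨M, -, hM⟩ := (hasBasis_cobounded_norm (E := ℂ)).eventually_iff.1 hCg.bound
  -- The radius is at least 1 so that `1 + |z| ≤ 2 |z|` outside the ball.
  refine MemLp.of_restrict_inter (measurableSet_ball (x := (0 : ℂ)) (ε := max M 1)) (hloc _) ?_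
  have h1 := (memLp_one_add_norm_inv_pow hp0 hp hn).restrict ((ball (0 : ℂ) (max M 1))ᶜ ∩ T)
  refine h1.of_le_mul (c := C * 2 ^ n) (hm.mono_measure (Measure.restrict_mono_set _ inter_subset_right)) ?_
  refine ae_restrict_of_ae_restrict_of_subset inter_subset_left
    ((ae_restrict_iff' measurableSet_ball.compl).2 (Eventually.of_forall fun z hz => ?_))
  simp only [mem_compl_iff, mem_ball_zero_iff, not_lt, max_le_iff] at hz
  have h2 := hM hz.1
  simp only [norm_mul, norm_pow, norm_one, mul_one] at h2
  have hz0 : 0 < ‖z‖ := by linarith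
  rw [Real.norm_of_nonneg (by positivity), ← div_eq_mul_inv, le_div_iff₀ (by positivity)]
  calc ‖g z‖ * (1 + ‖z‖) ^ n ≤ ‖g z‖ * (2 * ‖z‖) ^ n := by gcongr; linarith
    _ = ‖z‖ ^ n * ‖g z‖ * 2 ^ n := by rw [mul_pow]; ring
    _ ≤ C * 2 ^ n := by gcongr

theorem integrableOn_norm_rpow_ball {s : ℝ} (hs : -2 < s) (R : ℝ) :
    IntegrableOn (fun z : ℂ => ‖z‖ ^ s) (ball 0 R) volume := by
  rw [integrableOn_fun_norm_addHaar volume (f := fun y => y ^ s)]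
  rcases le_or_gt R 0 with hR | hR
  · simp [Ioo_eq_empty (not_lt.2 hR)]
  -- Polar coordinates contribute one more factor `y`, so the condition on the exponent is `s + 1 >
  -- -1`.
  refine ((intervalIntegral.integrableOn_Ioo_rpow_iff (s := s + 1) hR).2 (by linarith)).congr_fun
    (fun y hy => ?_) measurableSet_Ioo
  simp [Real.rpow_add hy.1, mul_comm]

theorem memLp_inv_sub_ball (hp0 : p ≠ 0) (hp2 : p < 2) (a : ℂ) (M : ℝ) :
    MemLp (fun z => (z - a)⁻¹) p (volume.restrict (ball 0 M)) := by
  have hp : p ≠ ∞ := (hp2.trans_le le_top).ne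
  have hq : p.toReal < 2 := by simpa using ENNReal.toReal_strict_mono (by norm_num) hp2
  have h1 : MemLp (fun z : ℂ => z⁻¹) p (volume.restrict (ball 0 (M + ‖a‖))) := by
    rw [← integrable_norm_rpow_iff measurable_inv.aestronglyMeasurable hp0 hp]
    refine (integrableOn_norm_rpow_ball (s := -p.toReal) (by linarith) _).congr
      (Eventually.of_forall fun z => ?_)
    simp [Real.rpow_neg, Real.inv_rpow]
  rw [← memLp_indicator_iff_restrict measurableSet_ball] at h1
  have h2 := h1.comp_measurePreserving (measurePreserving_sub_right volume a)
  refine ((h2.restrict (ball 0 M)).congr_norm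
    (Measurable.aestronglyMeasurable (by fun_prop)) ?_)
  refine (ae_restrict_iff' measurableSet_ball).2 (Eventually.of_forall fun z hz => ?_)
  rw [mem_ball_zero_iff] at hz
  have : z - a ∈ ball (0 : ℂ) (M + ‖a‖) := by
    rw [mem_ball_zero_iff]
    linarith [norm_sub_le z a]
  simp [indicator_of_mem this]

theorem memLp_sum_inv_sub {ι : Type*} (s : Finset ι) (a c : ι → ℂ) (hp0 : p ≠ 0) (hp2 : p < 2)
    {n : ℕ} (hn : 2 < n * p.toReal) {l : ℂ}
    (hl : Tendsto (fun z => z ^ n * ∑ j ∈ s, c j * (z - a j)⁻¹) (Bornology.cobounded ℂ) (𝓝 l)) :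
    MemLp (fun z => ∑ j ∈ s, c j * (z - a j)⁻¹) p volume := by
  rw [← Measure.restrict_univ (μ := volume)]
  refine memLp_restrict_of_isBigO_cobounded hp0 (hp2.trans_le le_top).ne hn (hl.isBigO_one ℝ)
    (Measurable.aestronglyMeasurable (by fun_prop)) fun M => ?_
  rw [inter_univ]
  exact memLp_finsetSum s fun j _ => (memLp_inv_sub_ball hp0 hp2 (a j) M).const_mul (c j)

end Membership

/-! ### The Bergman spaces of finitely punctured planes -/

section PuncturedPlane

variable {p : ℝ≥0∞} {k : ℕ} {a : Fin (k + 1) → ℂ}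

theorem isConnected_puncturedPlane (a : Fin (k + 1) → ℂ) :
    IsConnected (puncturedPlane a : Set ℂ) :=
  (finite_range a).countable.isConnected_compl_of_one_lt_rank (by simp)

theorem volume_restrict_puncturedPlane (a : Fin (k + 1) → ℂ) :
    (volume : Measure ℂ).restrict (puncturedPlane a : Set ℂ) = volume := by
  refine Measure.restrict_eq_self_of_ae_mem ?_
  filter_upwards [compl_mem_ae_iff.2 ((finite_range a).measure_zero volume)] with z hz using hz

theorem sub_ne_zero_of_puncturedPlane (z : puncturedPlane a) (j : Fin (k + 1)) :
    (z : ℂ) - a j ≠ 0 :=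
  sub_ne_zero.2 fun h => z.2 ⟨j, h.symm⟩

/-- The function `∑ c_j / (z - a_j)` with prescribed residues `c_j`. -/
noncomputable def poleSum (a : Fin (k + 1) → ℂ) :
    (Fin (k + 1) → ℂ) →ₗ[ℂ] (puncturedPlane a → ℂ) where
  toFun c z := ∑ j, c j * ((z : ℂ) - a j)⁻¹
  map_add' c d := by
    ext z
    simp [add_mul, Finset.sum_add_distrib]
  map_smul' r c := by
    ext z
    simp [Finset.mul_sum, mul_assoc]

/-- Each coefficient is recovered as the limit of `(z - a_i) f` at `a_i`. -/
theorem poleSum_injective (ha : Function.Injective a) : Function.Injective (poleSum a) := by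
  refine (injective_iff_map_eq_zero _).2 fun c hc => funext fun i => ?_
  have h1 := tendsto_sub_mul_sum_inv_sub Finset.univ ha c (Finset.mem_univ i)
  refine tendsto_nhds_unique (h1.congr' ?_) tendsto_const_nhds
  have : (range a \ {a i})ᶜ ∈ 𝓝 (a i) :=
    ((finite_range a).subset sdiff_subset).isClosed.isOpen_compl.mem_nhds (by simp)
  filter_upwards [nhdsWithin_le_nhds this, self_mem_nhdsWithin] with z hz hza
  have hz' : z ∈ puncturedPlane a := fun hzS => hz ⟨hzS, hza⟩
  have h2 := congrFun hc ⟨z, hz'⟩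
  change ∑ j, c j * (z - a j)⁻¹ = 0 at h2
  rw [h2, mul_zero, Pi.zero_apply]

theorem differentiableOn_sum_inv_sub_puncturedPlane (c : Fin (k + 1) → ℂ) :
    DifferentiableOn ℂ (fun z => ∑ j, c j * (z - a j)⁻¹) (puncturedPlane a) := by
  refine DifferentiableOn.fun_sum fun j _ z hz => ?_
  have := sub_ne_zero_of_puncturedPlane ⟨z, hz⟩ j
  fun_prop (disch := assumption)

theorem poleSum_mem_bergmanSubmodule (hp0 : p ≠ 0) (hp2 : p < 2) {c : Fin (k + 1) → ℂ}
    {n : ℕ} (hn : 2 < n * p.toReal) {l : ℂ}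
    (hl : Tendsto (fun z => z ^ n * ∑ j, c j * (z - a j)⁻¹) (Bornology.cobounded ℂ) (𝓝 l)) :
    poleSum a c ∈ bergmanSubmodule p (puncturedPlane a) := by
  refine (mem_bergmanSubmodule_iff (F := fun z => ∑ j, c j * (z - a j)⁻¹) fun z => rfl).2 ?_
  rw [volume_restrict_puncturedPlane]
  exact ⟨differentiableOn_sum_inv_sub_puncturedPlane c,
    memLp_sum_inv_sub _ a c hp0 hp2 hn hl⟩

/-- Elements of `A^p` of a punctured plane are sums of simple poles; their behaviour at infinity
determines the linear relations between the residues. -/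
theorem exists_poleSum_eq (ha : Function.Injective a) (hp1 : 1 ≤ p) (hp2 : p < 2)
    {f : puncturedPlane a → ℂ} (hf : f ∈ bergmanSubmodule p (puncturedPlane a)) :
    ∃ c : Fin (k + 1) → ℂ, poleSum a c = f ∧ ∑ j, c j = 0 ∧ (p = 1 → ∑ j, c j * a j = 0) := by
  classical
  have hp : p ≠ ∞ := (hp2.trans_le le_top).ne
  obtain ⟨hd, hm⟩ := hf
  rw [volume_restrict_puncturedPlane] at hm
  set S : Finset ℂ := Finset.univ.image a with hS
  have hSa : (puncturedPlane a : Set ℂ) = (S : Set ℂ)ᶜ := by simp [puncturedPlane, hS]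
  rw [hSa] at hd
  obtain ⟨c, hc⟩ := exists_eq_sum_inv_sub_of_memLp hp1 hp hd hm
  have hc' : ∀ z ∈ (S : Set ℂ)ᶜ, zeroExt f z = ∑ j, c (a j) * (z - a j)⁻¹ := by
    intro z hz
    rw [hc z hz, hS, Finset.sum_image ha.injOn]
  have hev : ∀ᶠ z in Bornology.cobounded ℂ, zeroExt f z = ∑ j, c (a j) * (z - a j)⁻¹ := by
    filter_upwards [S.finite_toSet.isBounded] with z hz using hc' z hz
  have hsum : ∑ j, c (a j) = 0 := by
    refine tendsto_nhds_unique (tendsto_mul_sum_inv_sub Finset.univ a fun j => c (a j))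
      ((tendsto_mul_of_memLp hp1 hp2.le hd hm).congr' ?_)
    filter_upwards [hev] with z hz
    rw [hz]
  refine ⟨fun j => c (a j), ?_, hsum, ?_⟩
  · ext z
    rw [← zeroExt_apply f z, hc' z (hSa ▸ z.2)]
    rfl
  · rintro rfl
    refine tendsto_nhds_unique (tendsto_sq_mul_sum_inv_sub Finset.univ a (fun j => c (a j)) hsum)
      ((tendsto_sq_mul_of_memLp_one hd hm).congr' ?_)
    filter_upwards [hev] with z hz
    rw [hz]

/-- The sum of the residues. -/
noncomputable def residueSum (k : ℕ) : (Fin (k + 1) → ℂ) →ₗ[ℂ] ℂ :=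
  ∑ j, LinearMap.proj j

theorem residueSum_apply (c : Fin (k + 1) → ℂ) : residueSum k c = ∑ j, c j := by
  simp [residueSum]

/-- The sum of the residues together with the first moment of the residues. -/
noncomputable def residueMoments (a : Fin (k + 1) → ℂ) : (Fin (k + 1) → ℂ) →ₗ[ℂ] ℂ × ℂ :=
  (residueSum k).prod (∑ j, a j • LinearMap.proj j)

theorem residueMoments_apply (c : Fin (k + 1) → ℂ) :
    residueMoments a c = (∑ j, c j, ∑ j, c j * a j) := by
  simp [residueMoments, residueSum_apply, mul_comm]

theorem bergmanSubmodule_puncturedPlane_of_one_lt (ha : Function.Injective a) (hp1 : 1 < p)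
    (hp2 : p < 2) :
    bergmanSubmodule p (puncturedPlane a) = (residueSum k).ker.map (poleSum a) := by
  ext f
  simp only [Submodule.mem_map, LinearMap.mem_ker, residueSum_apply]
  constructor
  · intro hf
    obtain ⟨c, hcf, hc, -⟩ := exists_poleSum_eq ha hp1.le hp2 hf
    exact ⟨c, hc, hcf⟩
  · rintro ⟨c, hc, rfl⟩
    have hq : 1 < p.toReal := by
      simpa using ENNReal.toReal_strict_mono (hp2.trans_le le_top).ne hp1
    -- A vanishing residue sum gives decay of order 2, and `2p > 2`.
    exact poleSum_mem_bergmanSubmodule (zero_lt_one.trans hp1).ne' hp2 (n := 2)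
      (by push_cast; linarith) (tendsto_sq_mul_sum_inv_sub _ a c hc)

theorem bergmanSubmodule_one_puncturedPlane (ha : Function.Injective a) :
    bergmanSubmodule 1 (puncturedPlane a) = (residueMoments a).ker.map (poleSum a) := by
  ext f
  simp only [Submodule.mem_map, LinearMap.mem_ker, residueMoments_apply, Prod.mk_eq_zero]
  constructor
  · intro hf
    obtain ⟨c, hcf, hc, hc'⟩ := exists_poleSum_eq ha le_rfl (by norm_num) hf
    exact ⟨c, ⟨hc, hc' rfl⟩, hcf⟩
  · rintro ⟨c, ⟨hc, hc'⟩, rfl⟩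
    -- Order 2 would fall just short of integrability in the plane; the vanishing first moment gives
    -- order 3.
    exact poleSum_mem_bergmanSubmodule one_ne_zero (by norm_num) (n := 3)
      (by norm_num) (tendsto_cube_mul_sum_inv_sub _ a c hc hc')

theorem finrank_ker_residueSum (k : ℕ) : Module.finrank ℂ (residueSum k).ker = k := by
  have hs : (residueSum k).range = ⊤ := by
    refine LinearMap.range_eq_top.2 fun x => ⟨Pi.single 0 x, ?_⟩
    rw [residueSum_apply, Finset.sum_pi_single']
    simp
  have h := (residueSum k).finrank_range_add_finrank_ker
  rw [hs, finrank_top] at h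
  simp at h
  omega

theorem finrank_ker_residueMoments {a : Fin (k + 2) → ℂ} (ha : Function.Injective a) :
    Module.finrank ℂ (residueMoments a).ker = k := by
  have h01 : a 1 - a 0 ≠ 0 := sub_ne_zero.2 (ha.ne (by simp))
  have hs : (residueMoments a).range = ⊤ := by
    refine LinearMap.range_eq_top.2 fun x => ?_
    -- Residues at two distinct points suffice to prescribe both sum and first moment; `t` solves
    -- that 2 by 2 system.
    set t := (x.2 - x.1 * a 0) / (a 1 - a 0) with ht
    refine ⟨Pi.single 0 (x.1 - t) + Pi.single 1 t, ?_⟩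
    rw [residueMoments_apply]
    simp only [Pi.add_apply, Finset.sum_add_distrib, add_mul, Pi.single_apply,
      ite_mul, zero_mul, Finset.sum_ite_eq', Finset.mem_univ, if_true]
    ext
    · simp
    · have : t * (a 1 - a 0) = x.2 - x.1 * a 0 := by rw [ht]; field_simp
      simp only
      linear_combination this
  have h := (residueMoments a).finrank_range_add_finrank_ker
  rw [hs, finrank_top] at h
  simp at h
  omega

theorem rank_bergmanSpace_of_eq_map {Ω : Opens ℂ} {m d : ℕ} {V : Submodule ℂ (Fin m → ℂ)}
    {L : (Fin m → ℂ) →ₗ[ℂ] (Ω → ℂ)} (hL : Function.Injective L)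
    (h : bergmanSubmodule p Ω = V.map L) (hV : Module.finrank ℂ V = d) :
    Module.rank ℂ (BergmanSpace p Ω) = d := by
  change Module.rank ℂ (bergmanSubmodule p Ω) = d
  rw [h, ← (Submodule.equivMapOfInjective L hL V).rank_eq, ← Module.finrank_eq_rank, hV]

theorem rank_bergmanSpace_puncturedPlane (ha : Function.Injective a) (hp1 : 1 < p) (hp2 : p < 2) :
    Module.rank ℂ (BergmanSpace p (puncturedPlane a)) = k :=
  rank_bergmanSpace_of_eq_map (poleSum_injective ha)
    (bergmanSubmodule_puncturedPlane_of_one_lt ha hp1 hp2) (finrank_ker_residueSum k)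

theorem rank_bergmanSpace_one_puncturedPlane {a : Fin (k + 2) → ℂ} (ha : Function.Injective a) :
    Module.rank ℂ (BergmanSpace 1 (puncturedPlane a)) = k :=
  rank_bergmanSpace_of_eq_map (poleSum_injective ha)
    (bergmanSubmodule_one_puncturedPlane ha) (finrank_ker_residueMoments ha)

theorem exists_isConnected_rank_bergmanSpace_eq (hp1 : 1 ≤ p) (hp2 : p < 2) (k : ℕ) :
    ∃ Ω : Opens ℂ, IsConnected (Ω : Set ℂ) ∧ Module.rank ℂ (BergmanSpace p Ω) = k := by
  have hinj (m : ℕ) : Function.Injective fun j : Fin m => ((j : ℕ) : ℂ) :=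
    Nat.cast_injective.comp Fin.val_injective
  rcases hp1.eq_or_lt with rfl | hp1
  · exact ⟨_, isConnected_puncturedPlane _, rank_bergmanSpace_one_puncturedPlane (hinj (k + 2))⟩
  · exact ⟨_, isConnected_puncturedPlane _,
      rank_bergmanSpace_puncturedPlane (hinj (k + 1)) hp1 hp2⟩

theorem exists_basis_bergmanSpace_puncturedPlane (ha : Function.Injective a) (hp1 : 1 < p)
    (hp2 : p < 2) :
    ∃ b : Module.Basis (Fin k) ℂ (BergmanSpace p (puncturedPlane a)),
      ∀ (j : Fin k) (z : puncturedPlane a),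
        b j z = 1 / ((z : ℂ) - a 0) - 1 / ((z : ℂ) - a j.succ) := by
  set e : Fin k → Fin (k + 1) → ℂ := fun j => Pi.single 0 1 - Pi.single j.succ 1 with he
  have heker (j : Fin k) : e j ∈ (residueSum k).ker := by
    rw [LinearMap.mem_ker, residueSum_apply]
    simp [he, Finset.sum_sub_distrib]
  have hmem (j : Fin k) : poleSum a (e j) ∈ bergmanSubmodule p (puncturedPlane a) := by
    rw [bergmanSubmodule_puncturedPlane_of_one_lt ha hp1 hp2]
    exact Submodule.mem_map_of_mem (heker j)
  set v : Fin k → bergmanSubmodule p (puncturedPlane a) := fun j => ⟨poleSum a (e j), hmem j⟩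
  have hli_e : LinearIndependent ℂ e := by
    -- Coordinate `i.succ` of a combination of the `e j` is minus the coefficient of `e i`.
    rw [Fintype.linearIndependent_iff]
    intro g hg i
    have := congrFun hg i.succ
    simpa [he, Finset.sum_apply, Pi.single_apply] using this
  have hli : LinearIndependent ℂ v := by
    refine LinearIndependent.of_comp (bergmanSubmodule p (puncturedPlane a)).subtype ?_
    exact hli_e.map' (poleSum a) (LinearMap.ker_eq_bot.2 (poleSum_injective ha))
  have hrank : Module.rank ℂ (bergmanSubmodule p (puncturedPlane a)) = k :=
    rank_bergmanSpace_puncturedPlane ha hp1 hp2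
  have hfin : Module.finrank ℂ (bergmanSubmodule p (puncturedPlane a)) = k :=
    Module.finrank_eq_of_rank_eq hrank
  have : Module.Finite ℂ (bergmanSubmodule p (puncturedPlane a)) :=
    Module.rank_lt_aleph0_iff.1 (hrank ▸ Cardinal.natCast_lt_aleph0)
  have hspan : ⊤ ≤ Submodule.span ℂ (range v) :=
    (hli.span_eq_top_of_card_eq_finrank' (by simp [hfin])).ge
  let b : Module.Basis (Fin k) ℂ (bergmanSubmodule p (puncturedPlane a)) := Module.Basis.mk hli hspan
  refine ⟨b, fun j z => ?_⟩
  have h1 : b j = v j := Module.Basis.mk_apply hli hspan j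
  change (b j).1 z = _
  rw [h1]
  change ∑ i, e j i * ((z : ℂ) - a i)⁻¹ = _
  simp [he, sub_mul, Finset.sum_sub_distrib, Pi.single_apply]

end PuncturedPlane

/-! ### Completeness -/

section Completeness

variable {p : ℝ≥0∞} {Ω : Opens ℂ}

theorem BergmanSpace.zeroExt_sub (f g : BergmanSpace p Ω) :
    zeroExt (f - g).toFun = zeroExt f.toFun - zeroExt g.toFun := by
  have h := Function.extend_sub (Subtype.val : Ω → ℂ) f.toFun g.toFun 0 0
  rwa [sub_zero] at h

theorem BergmanSpace.differentiableOn (f : BergmanSpace p Ω) :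
    DifferentiableOn ℂ (zeroExt f.toFun) Ω := f.2.1

/-- Point evaluations on `A^p(Ω)` are locally uniformly bounded. -/
theorem BergmanSpace.norm_zeroExt_le [Fact (1 ≤ p)] (hp : p ≠ ∞) (f : BergmanSpace p Ω) {z : ℂ}
    {r : ℝ} (hr : 0 < r) (hz : ball z r ⊆ Ω) :
    ‖zeroExt f.toFun z‖ ≤ ‖f‖ * r ^ (-(2 / p.toReal)) := by
  refine (f.differentiableOn.mono hz).norm_mul_rpow_le_of_eLpNorm_le hr (norm_nonneg _) Fact.out hp
    ?_
  rw [BergmanSpace.norm_def, ENNReal.ofReal_toReal f.memLp.eLpNorm_ne_top]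
  exact eLpNorm_mono_measure _ (Measure.restrict_mono_set _ hz)

/-- A Cauchy sequence converges in `L^p` and, by the bounds on point evaluations, locally uniformly
on `Ω`. The locally uniform limit is holomorphic and agrees almost everywhere with the `L^p` limit,
as a subsequence shows. -/
theorem BergmanSpace.completeSpace [Fact (1 ≤ p)] (hp : p ≠ ∞) :
    CompleteSpace (BergmanSpace p Ω) := by
  refine Metric.complete_of_cauchySeq_tendsto fun u hu => ?_
  have hiso : Isometry (BergmanSpace.toLp : BergmanSpace p Ω →ₗ[ℂ] _) :=
    AddMonoidHomClass.isometry_of_norm _ fun _ => rfl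
  obtain ⟨g, hg⟩ := cauchySeq_tendsto_of_complete (hiso.uniformContinuous.comp_cauchySeq hu)
  set F : ℕ → ℂ → ℂ := fun n => zeroExt (u n).toFun with hF
  have hunif : ∀ z ∈ (Ω : Set ℂ), ∃ t ∈ 𝓝[(Ω : Set ℂ)] z, UniformCauchySeqOn F atTop t := by
    intro z hz
    obtain ⟨r, hr, hrΩ⟩ := Metric.isOpen_iff.1 Ω.isOpen z hz
    refine ⟨ball z (r / 2), nhdsWithin_le_nhds (ball_mem_nhds z (by positivity)), ?_⟩
    refine Metric.uniformCauchySeqOn_iff.2 fun ε hε => ?_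
    set K := (r / 2) ^ (-(2 / p.toReal)) with hK
    have hKpos : 0 < K := by positivity
    obtain ⟨N, hN⟩ := Metric.cauchySeq_iff.1 hu (ε / K) (by positivity)
    refine ⟨N, fun m hm n hn w hw => ?_⟩
    have hsub : ball w (r / 2) ⊆ Ω := fun x hx => hrΩ (mem_ball.2 (by
      have h1 := mem_ball.1 hx
      have h2 := mem_ball.1 hw
      linarith [dist_triangle x w z]))
    have h1 := (u m - u n).norm_zeroExt_le hp (half_pos hr) hsub
    have h2 := hN m hm n hn
    rw [dist_eq_norm] at h2 ⊢
    rw [BergmanSpace.zeroExt_sub, Pi.sub_apply] at h1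
    calc _ ≤ ‖u m - u n‖ * K := h1
      _ < ε / K * K := by gcongr
      _ = ε := by field_simp
  have hpt : ∀ z ∈ (Ω : Set ℂ), ∃ l, Tendsto (fun n => F n z) atTop (𝓝 l) := by
    intro z hz
    obtain ⟨t, ht, hF⟩ := hunif z hz
    exact cauchySeq_tendsto_of_complete (hF.cauchySeq (mem_of_mem_nhdsWithin hz ht))
  choose! G hG using hpt
  have hloc : TendstoLocallyUniformlyOn F G atTop (Ω : Set ℂ) := by
    refine tendstoLocallyUniformlyOn_of_forall_exists_nhds fun z hz => ?_
    obtain ⟨t, ht, hF⟩ := hunif z hz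
    refine ⟨t ∩ Ω, inter_mem ht self_mem_nhdsWithin, ?_⟩
    exact (hF.mono inter_subset_left).tendstoUniformlyOn_of_tendsto fun w hw => hG w hw.2
  have hGd : DifferentiableOn ℂ G Ω :=
    hloc.differentiableOn (Eventually.of_forall fun n => (u n).differentiableOn) Ω.isOpen
  obtain ⟨φ, hφ, hφg⟩ := (tendstoInMeasure_of_tendsto_Lp hg).exists_seq_tendsto_ae
  have hGg : G =ᵐ[volume.restrict (Ω : Set ℂ)] g := by
    have h1 : ∀ᵐ z ∂(volume.restrict (Ω : Set ℂ)), ∀ n,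
        (BergmanSpace.toLp (u n) : ℂ → ℂ) z = F n z :=
      ae_all_iff.2 fun n => MemLp.coeFn_toLp (u n).memLp
    filter_upwards [hφg, h1, ae_restrict_mem Ω.isOpen.measurableSet] with z hz h1 hzΩ
    refine tendsto_nhds_unique ((hG z hzΩ).comp hφ.tendsto_atTop) (hz.congr fun n => ?_)
    exact h1 _
  have hGp : MemLp G p (volume.restrict (Ω : Set ℂ)) := (memLp_congr_ae hGg).2 (Lp.memLp g)
  have hmem : (fun z : Ω => G z) ∈ bergmanSubmodule p Ω :=
    (mem_bergmanSubmodule_iff fun _ => rfl).2 ⟨hGd, hGp⟩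
  set f : BergmanSpace p Ω := ⟨_, hmem⟩ with hf
  refine ⟨f, hiso.isEmbedding.tendsto_nhds_iff.2 ?_⟩
  have hfg : BergmanSpace.toLp f = g := by
    refine Lp.ext ((MemLp.coeFn_toLp f.memLp).trans (EventuallyEq.trans ?_ hGg))
    filter_upwards [ae_restrict_mem Ω.isOpen.measurableSet] with z hz
    exact zeroExt_apply f.toFun ⟨z, hz⟩
  rw [hfg]
  exact hg

end Completeness

/-! ### Bounded holomorphic multipliers -/

section BoundedMultipliers

variable {p : ℝ≥0∞} {Ω : Opens ℂ}

theorem mul_mem_bergmanSubmodule {F : ℂ → ℂ} (hF : DifferentiableOn ℂ F Ω) {C : ℝ}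
    (hC : ∀ z ∈ Ω, ‖F z‖ ≤ C) {f : Ω → ℂ} (hf : f ∈ bergmanSubmodule p Ω) :
    (fun z : Ω => F z) * f ∈ bergmanSubmodule p Ω := by
  refine (mem_bergmanSubmodule_iff (F := F * zeroExt f) fun z => ?_).2 ⟨hF.mul hf.1, ?_⟩
  · simp only [Pi.mul_apply, zeroExt_apply]
  · refine hf.2.of_le_mul (c := C)
      ((hF.mul hf.1).continuousOn.aestronglyMeasurable Ω.isOpen.measurableSet) ?_
    filter_upwards [ae_restrict_mem Ω.isOpen.measurableSet] with z hz
    rw [Pi.mul_apply, norm_mul]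
    gcongr
    exact hC z hz

/-- On a nonzero finite-dimensional `A^p(Ω)`, multiplication by a bounded holomorphic function has
an eigenvalue, hence the function is constant. -/
theorem exists_eqOn_const_of_finiteDimensional (hΩ : IsConnected (Ω : Set ℂ))
    [FiniteDimensional ℂ (bergmanSubmodule p Ω)] [Nontrivial (bergmanSubmodule p Ω)]
    {F : ℂ → ℂ} (hF : DifferentiableOn ℂ F Ω) {C : ℝ} (hC : ∀ z ∈ Ω, ‖F z‖ ≤ C) :
    ∃ c, ∀ z ∈ Ω, F z = c := by
  set T : Module.End ℂ (bergmanSubmodule p Ω) :=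
    (LinearMap.mulLeft ℂ fun z : Ω => F z).restrict fun f hf => mul_mem_bergmanSubmodule hF hC hf
    with hT
  obtain ⟨c, hc⟩ := Module.End.exists_eigenvalue T
  obtain ⟨v, hv⟩ := hc.exists_hasEigenvector
  have hmul (z : Ω) : F z * v.1 z = c * v.1 z :=
    congrFun (congrArg Subtype.val hv.apply_eq_smul) z
  obtain ⟨z₀, hz₀⟩ : ∃ z₀, v.1 z₀ ≠ 0 := by
    by_contra! h
    exact hv.2 (Subtype.ext (funext h))
  have hcont : ContinuousAt (zeroExt v.1) z₀ :=
    v.2.1.continuousOn.continuousAt (Ω.isOpen.mem_nhds z₀.2)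
  -- The eigenvector has no zero near `z₀`, so it cancels from the eigenvalue equation; the identity
  -- theorem then spreads `F = c` over `Ω`.
  have hev : F =ᶠ[𝓝 (z₀ : ℂ)] fun _ => c := by
    filter_upwards [hcont.eventually_ne (by rwa [zeroExt_apply]), Ω.isOpen.mem_nhds z₀.2] with z hz hzΩ
    have h1 := zeroExt_apply v.1 ⟨z, hzΩ⟩
    rw [h1] at hz
    exact mul_right_cancel₀ hz (hmul ⟨z, hzΩ⟩)
  exact ⟨c, (hF.analyticOnNhd Ω.isOpen).eqOn_of_preconnected_of_eventuallyEq analyticOnNhd_const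
    hΩ.isPreconnected z₀.2 hev⟩

end BoundedMultipliers

/-! ### Cauchy transforms of planar sets -/

section CauchyTransform

variable {E : Set ℂ}

/-- The kernel `1 / |z - w|` is integrable over the unit disc about `w`, with an integral
independent of `w`, and is at most 1 outside it. -/
theorem exists_norm_setIntegral_inv_sub_le (hE : volume E ≠ ∞) :
    ∃ C, ∀ w, ‖∫ z in E, (z - w)⁻¹‖ ≤ C := by
  set h : ℂ → ℝ := (ball (0 : ℂ) 1).indicator fun z => ‖z‖ ^ (-1 : ℝ) with hh
  have hh0 (z : ℂ) : 0 ≤ h z := indicator_nonneg (fun z _ => by positivity) z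
  have hintegrable : Integrable h volume :=
    (integrable_indicator_iff measurableSet_ball).2 (integrableOn_norm_rpow_ball (by norm_num) 1)
  have hfin : IsFiniteMeasure (volume.restrict E) := ⟨by simpa using hE.lt_top⟩
  refine ⟨(∫ z, h z) + volume.real E, fun w => ?_⟩
  have hw : Integrable (fun z => h (z - w)) volume := hintegrable.comp_sub_right w
  have hle (z : ℂ) : ‖(z - w)⁻¹‖ ≤ h (z - w) + 1 := by
    rw [norm_inv]
    by_cases hz : z - w ∈ ball (0 : ℂ) 1
    · rw [hh, indicator_of_mem hz, Real.rpow_neg_one]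
      linarith
    · rw [mem_ball_zero_iff, not_lt] at hz
      linarith [hh0 (z - w), inv_le_one_of_one_le₀ hz]
  calc ‖∫ z in E, (z - w)⁻¹‖ ≤ ∫ z in E, (h (z - w) + 1) :=
        norm_integral_le_of_norm_le (hw.integrableOn.add (integrable_const 1))
          (Eventually.of_forall hle)
    _ = (∫ z in E, h (z - w)) + volume.real E := by
        rw [integral_add hw.integrableOn (integrable_const 1)]
        simp
    _ ≤ (∫ z, h (z - w)) + volume.real E := by
        gcongr ?_ + _
        exact setIntegral_le_integral hw (Eventually.of_forall fun z => hh0 _)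
    _ = (∫ z, h z) + volume.real E := by rw [integral_sub_right_eq_self h w]

theorem hasDerivAt_setIntegral_inv_sub (hE : IsCompact E) {w₀ : ℂ} (hw : w₀ ∉ E) :
    HasDerivAt (fun w => ∫ z in E, (z - w)⁻¹) (∫ z in E, ((z - w₀) ^ 2)⁻¹) w₀ := by
  obtain ⟨r, hr, hrE⟩ := Metric.isOpen_iff.1 hE.isClosed.isOpen_compl w₀ hw
  have hfin : IsFiniteMeasure (volume.restrict E) := ⟨by simpa using hE.measure_lt_top⟩
  have hdist : ∀ z ∈ E, ∀ w ∈ ball w₀ (r / 2), r / 2 ≤ ‖z - w‖ := by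
    intro z hz w hw
    by_contra! h
    refine hrE (mem_ball.2 ?_) hz
    have h1 := mem_ball.1 hw
    have h2 := dist_triangle z w w₀
    rw [dist_eq_norm z w] at h2
    linarith
  refine (hasDerivAt_integral_of_dominated_loc_of_deriv_le (F := fun w z => (z - w)⁻¹)
    (F' := fun w z => ((z - w) ^ 2)⁻¹) (bound := fun _ => ((r / 2) ^ 2)⁻¹)
    (ball_mem_nhds w₀ (half_pos hr))
    (Eventually.of_forall fun w => Measurable.aestronglyMeasurable (by fun_prop)) ?_
    (Measurable.aestronglyMeasurable (by fun_prop)) ?_ (integrable_const _) ?_).2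
  · refine Integrable.of_bound (Measurable.aestronglyMeasurable (by fun_prop)) (r / 2)⁻¹ ?_
    filter_upwards [ae_restrict_mem hE.measurableSet] with z hz
    rw [norm_inv]
    exact inv_anti₀ (half_pos hr) (hdist z hz w₀ (mem_ball_self (half_pos hr)))
  · filter_upwards [ae_restrict_mem hE.measurableSet] with z hz w hw
    rw [norm_inv, norm_pow]
    have := hdist z hz w hw
    exact inv_anti₀ (by positivity) (by gcongr)
  · filter_upwards [ae_restrict_mem hE.measurableSet] with z hz w hw
    have h0 : z - w ≠ 0 := norm_pos_iff.1 ((half_pos hr).trans_le (hdist z hz w hw))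
    have := ((hasDerivAt_id w).const_sub z).fun_inv h0
    simpa using this

/-- At infinity the transform behaves like `-area / w`. Being constant on an unbounded set, it is
zero there; then `z / (z - w) = 1 + w / (z - w)` integrates over `E` to the area of `E`, although
the integrand is small for large `w`. -/
theorem volume_eq_zero_of_setIntegral_inv_sub_eq (hE : IsCompact E) {U : Set ℂ}
    (hU : ¬ Bornology.IsBounded U) {c : ℂ} (h : ∀ w ∈ U, ∫ z in E, (z - w)⁻¹ = c) :
    volume E = 0 := by
  obtain ⟨R, hR, hER⟩ := hE.isBounded.subset_ball_lt 0 0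
  have hlarge (M : ℝ) : ∃ w ∈ U, M < ‖w‖ := by
    by_contra! hM
    exact hU (isBounded_iff_forall_norm_le.2 ⟨M, hM⟩)
  have hvt : volume E ≠ ∞ := hE.measure_lt_top.ne
  set v := volume.real E with hv
  have hdist {z w : ℂ} (hz : z ∈ E) : ‖w‖ - R ≤ ‖z - w‖ := by
    have h1 := mem_ball_zero_iff.1 (hER hz)
    have h2 := norm_sub_norm_le w z
    rw [norm_sub_rev] at h2
    linarith
  have hc : c = 0 := by
    by_contra hc
    have hc0 : 0 < ‖c‖ := norm_pos_iff.2 hc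
    -- So far out, the transform is bounded by `|c| v / (v + 1) < |c|`.
    obtain ⟨w, hwU, hw⟩ := hlarge (R + (v + 1) / ‖c‖)
    have hpos : 0 < (v + 1) / ‖c‖ := by positivity
    have h1 : ‖c‖ ≤ ((v + 1) / ‖c‖)⁻¹ * v := by
      rw [← h w hwU]
      refine norm_setIntegral_le_of_norm_le_const hE.measure_lt_top fun z hz => ?_
      rw [h w hwU, norm_inv]
      exact inv_anti₀ hpos (by linarith [hdist (w := w) hz])
    have h2 : ((v + 1) / ‖c‖)⁻¹ * v = ‖c‖ * (v / (v + 1)) := by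
      field_simp
    have h3 : v / (v + 1) < 1 := (div_lt_one (by positivity)).2 (by linarith)
    rw [h2] at h1
    nlinarith
  -- Then `|z - w| > 2R` and `|z| < R` on `E`, so `|z / (z - w)| ≤ 1/2`.
  obtain ⟨w, hwU, hw⟩ := hlarge (3 * R)
  have hfin : IsFiniteMeasure (volume.restrict E) := ⟨by simpa using hE.measure_lt_top⟩
  have hintegrable : IntegrableOn (fun z => (z - w)⁻¹) E volume := by
    refine Integrable.of_bound (Measurable.aestronglyMeasurable (by fun_prop)) R⁻¹ ?_
    filter_upwards [ae_restrict_mem hE.measurableSet] with z hz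
    rw [norm_inv]
    exact inv_anti₀ hR (by linarith [hdist (w := w) hz])
  have h1 : ∫ z in E, z * (z - w)⁻¹ = v := by
    calc ∫ z in E, z * (z - w)⁻¹ = ∫ z in E, (1 + w * (z - w)⁻¹) := by
          refine setIntegral_congr_fun hE.measurableSet fun z hz => ?_
          have : z - w ≠ 0 := norm_pos_iff.1 (by linarith [hdist (w := w) hz])
          field_simp
          ring
      _ = v := by
          rw [integral_add (integrable_const _) (hintegrable.const_mul w), integral_const_mul, h w hwU, hc]
          simp [hv]
  have h2 : ‖∫ z in E, z * (z - w)⁻¹‖ ≤ 1 / 2 * v := by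
    refine norm_setIntegral_le_of_norm_le_const hE.measure_lt_top fun z hz => ?_
    have h3 := mem_ball_zero_iff.1 (hER hz)
    have h4 := hdist (w := w) hz
    rw [norm_mul, norm_inv, ← div_eq_mul_inv, div_le_iff₀ (by linarith)]
    linarith
  rw [h1, Complex.norm_real, Real.norm_of_nonneg measureReal_nonneg] at h2
  have hv0 : v = 0 := le_antisymm (by linarith) measureReal_nonneg
  exact (measureReal_eq_zero_iff hvt).1 hv0

/-- An open set whose complement has positive area carries a nonconstant bounded holomorphic
function. -/
theorem exists_bounded_nonconstant {Ω : Opens ℂ} (hΩ : (Ω : Set ℂ).Nonempty)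
    (hvol : volume (Ω : Set ℂ)ᶜ ≠ 0) :
    ∃ F : ℂ → ℂ, DifferentiableOn ℂ F Ω ∧ (∃ C, ∀ z ∈ Ω, ‖F z‖ ≤ C) ∧
      ¬ ∃ c, ∀ z ∈ Ω, F z = c := by
  -- Nonconstancy of the Cauchy transform is read off at infinity, which needs `Ω` unbounded; on a
  -- bounded `Ω` the identity function serves.
  by_cases hb : Bornology.IsBounded (Ω : Set ℂ)
  · refine ⟨id, differentiableOn_id, isBounded_iff_forall_norm_le.1 hb, ?_⟩
    rintro ⟨c, hc⟩
    obtain ⟨z, hz⟩ := hΩ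
    refine infinite_of_mem_nhds z (Ω.isOpen.mem_nhds hz) ((finite_singleton c).subset fun w hw => hc w hw)
  · obtain ⟨E, hEΩ, hE, hE0⟩ := Ω.isOpen.measurableSet.compl.exists_lt_isCompact
      (pos_iff_ne_zero.2 hvol)
    obtain ⟨C, hC⟩ := exists_norm_setIntegral_inv_sub_le hE.measure_lt_top.ne
    refine ⟨fun w => ∫ z in E, (z - w)⁻¹, fun w hw => ?_, ⟨C, fun z _ => hC z⟩, ?_⟩
    · exact (hasDerivAt_setIntegral_inv_sub hE fun h => hEΩ h hw).differentiableAt.differentiableWithinAt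
    · rintro ⟨c, hc⟩
      exact hE0.ne' (volume_eq_zero_of_setIntegral_inv_sub_eq hE hb hc)

end CauchyTransform

/-! ### Divided differences and the dichotomy for `p ≥ 2` -/

section DividedDifferences

variable {p : ℝ≥0∞} {Ω : Opens ℂ}

/-- Combinations of divided differences of `f ∈ A^p(Ω)` whose `1 / z` terms at infinity cancel
belong to `A^p(Ω)`. -/
theorem sum_dslope_mem_bergmanSubmodule {ι : Type*} [Fintype ι] (hp1 : 1 < p) (hp : p ≠ ∞)
    {f : Ω → ℂ} (hf : f ∈ bergmanSubmodule p Ω) {c : ι → ℂ} (hc : ∀ i, c i ∈ Ω)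
    (α : ι → ℂ) (hα : ∑ i, α i * zeroExt f (c i) = 0) :
    (fun z : Ω => ∑ i, α i * dslope (zeroExt f) (c i) z) ∈ bergmanSubmodule p Ω := by
  set F := zeroExt f with hF
  have hd : DifferentiableOn ℂ (fun z => ∑ i, α i * dslope F (c i) z) Ω :=
    DifferentiableOn.fun_sum fun i _ =>
      ((Complex.differentiableOn_dslope (Ω.isOpen.mem_nhds (hc i))).2 hf.1).const_mul _
  refine (mem_bergmanSubmodule_iff (F := fun z => ∑ i, α i * dslope F (c i) z) fun z => rfl).2
    ⟨hd, ?_⟩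
  have hq : 1 < p.toReal := by simpa using ENNReal.toReal_strict_mono hp hp1
  have hball (i : ι) : ∃ δ > 0, closedBall (c i) δ ⊆ Ω :=
    Metric.nhds_basis_closedBall.mem_iff.1 (Ω.isOpen.mem_nhds (hc i))
  choose δ hδ hδΩ using hball
  set K : Set ℂ := ⋃ i, closedBall (c i) (δ i) with hK
  have hKc : IsCompact K := isCompact_iUnion fun i => isCompact_closedBall _ _
  have hKΩ : K ⊆ Ω := iUnion_subset hδΩ
  have hfar {z : ℂ} (hz : z ∉ K) (i : ι) : δ i ≤ ‖z - c i‖ := by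
    by_contra! h
    exact hz (mem_iUnion.2 ⟨i, mem_closedBall.2 (by rw [dist_eq_norm]; exact h.le)⟩)
  have hpole {z : ℂ} (hz : z ∉ K) (β : ι → ℂ) :
      ‖∑ i, β i * (z - c i)⁻¹‖ ≤ ∑ i, ‖β i‖ * (δ i)⁻¹ := by
    refine norm_sum_le_of_le _ fun i _ => ?_
    rw [norm_mul, norm_inv]
    gcongr
    · exact hδ i
    · exact hfar hz i
  have hmeas : MeasurableSet (Kᶜ ∩ Ω) := hKc.measurableSet.compl.inter Ω.isOpen.measurableSet
  -- On the compact `K` the function is continuous, hence bounded. Off `K` it is `f` times a bounded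
  -- pole sum, minus a pole sum whose residues cancel by `hα`; the latter decays to order 2, which
  -- suffices as `p > 1`.
  refine MemLp.of_restrict_inter hKc.measurableSet ?_ ?_
  · rw [inter_eq_left.2 hKΩ]
    have hfin : IsFiniteMeasure (volume.restrict K) := ⟨by simpa using hKc.measure_lt_top⟩
    obtain ⟨C, hC⟩ := hKc.exists_bound_of_continuousOn (hd.continuousOn.mono hKΩ)
    refine MemLp.of_bound ((hd.continuousOn.mono hKΩ).aestronglyMeasurable hKc.measurableSet) C ?_
    filter_upwards [ae_restrict_mem hKc.measurableSet] with z hz using hC z hz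
  · have h1 : MemLp (fun z => (∑ i, α i * (z - c i)⁻¹) * F z) p (volume.restrict (Kᶜ ∩ Ω)) := by
      have hFK : MemLp F p (volume.restrict (Kᶜ ∩ Ω)) :=
        hf.2.mono_measure (Measure.restrict_mono_set _ inter_subset_right)
      refine hFK.of_le_mul (c := ∑ i, ‖α i‖ * (δ i)⁻¹)
        ((Measurable.aestronglyMeasurable (by fun_prop)).mul hFK.aestronglyMeasurable) ?_
      filter_upwards [ae_restrict_mem hmeas] with z hz
      rw [norm_mul]
      gcongr
      exact hpole hz.1 α
    have h2 : MemLp (fun z => ∑ i, α i * F (c i) * (z - c i)⁻¹) p (volume.restrict (Kᶜ ∩ Ω)) := by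
      refine memLp_restrict_of_isBigO_cobounded (zero_lt_one.trans hp1).ne' hp (n := 2)
        (by push_cast; linarith) ((tendsto_sq_mul_sum_inv_sub Finset.univ c
          (fun i => α i * F (c i)) hα).isBigO_one ℝ)
        (Measurable.aestronglyMeasurable (by fun_prop)) fun M => ?_
      have hfin : IsFiniteMeasure (volume.restrict (ball (0 : ℂ) M ∩ (Kᶜ ∩ Ω))) :=
        ⟨by simpa using (measure_mono inter_subset_left).trans_lt measure_ball_lt_top⟩
      refine MemLp.of_bound (Measurable.aestronglyMeasurable (by fun_prop))
        (∑ i, ‖α i * F (c i)‖ * (δ i)⁻¹) ?_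
      filter_upwards [ae_restrict_mem (measurableSet_ball.inter hmeas)] with z hz
      exact hpole hz.2.1 _
    refine (memLp_congr_ae ?_).1 (h1.sub h2)
    filter_upwards [ae_restrict_mem hmeas] with z hz
    rw [Pi.sub_apply, Finset.sum_mul, ← Finset.sum_sub_distrib]
    refine Finset.sum_congr rfl fun i _ => ?_
    have hz0 : z - c i ≠ 0 := norm_pos_iff.1 ((hδ i).trans_le (hfar hz.1 i))
    rw [dslope_of_ne _ (sub_ne_zero.1 hz0), slope_def_field]
    field_simp

open Polynomial in
/-- A sum of simple poles is a quotient of a polynomial by the product of the denominators. -/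
theorem exists_polynomial_eval_eq_sum_inv_sub {ι : Type*} [Fintype ι] (c : ι → ℂ)
    (hc : Function.Injective c) (α : ι → ℂ) :
    ∃ P : ℂ[X], (α ≠ 0 → P ≠ 0) ∧
      ∀ z ∉ range c, P.eval z = (∏ j, (z - c j)) * ∑ i, α i * (z - c i)⁻¹ := by
  classical
  refine ⟨∑ i, C (α i) * ∏ j ∈ Finset.univ.erase i, (X - C (c j)), fun hα hP => hα (funext fun i => ?_),
    fun z hz => ?_⟩
  -- At `c i` only the `i`-th summand survives, and its product is nonzero because the points are
  -- distinct.
  · have h := congrArg (Polynomial.eval (c i)) hP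
    rw [eval_finsetSum, Finset.sum_eq_single i, eval_zero, eval_mul, eval_C, mul_eq_zero] at h
    · refine h.resolve_right ?_
      rw [eval_prod]
      refine Finset.prod_ne_zero_iff.2 ?_
      intro j hj
      simpa using sub_ne_zero.2 (hc.ne (Finset.ne_of_mem_erase hj).symm)
    · intro j _ hji
      rw [eval_mul, eval_prod, Finset.prod_eq_zero (Finset.mem_erase.2 ⟨hji.symm, Finset.mem_univ i⟩),
        mul_zero]
      simp
    · simp
  · rw [eval_finsetSum, Finset.mul_sum]
    refine Finset.sum_congr rfl fun i _ => ?_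
    have hz0 : z - c i ≠ 0 := sub_ne_zero.2 fun h => hz ⟨i, h.symm⟩
    rw [eval_mul, eval_prod, eval_C, ← Finset.mul_prod_erase _ _ (Finset.mem_univ i)]
    simp only [eval_sub, eval_X, eval_C]
    field_simp

/-- If the complement of `Ω` is a null set, then a finite-dimensional `A^p(Ω)` with `p ≥ 2` consists
of rational functions that are `p`-integrable on the plane, hence is zero. -/
theorem eq_zero_of_finiteDimensional_of_volume_compl (hΩ : (Ω : Set ℂ).Nonempty) (hp2 : 2 ≤ p)
    (hp : p ≠ ∞) (hvol : volume (Ω : Set ℂ)ᶜ = 0) [FiniteDimensional ℂ (bergmanSubmodule p Ω)]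
    {f : Ω → ℂ} (hf : f ∈ bergmanSubmodule p Ω) : f = 0 := by
  classical
  have hp1 : 1 < p := lt_of_lt_of_le (by norm_num) hp2
  have hrestrict : (volume : Measure ℂ).restrict (Ω : Set ℂ) = volume :=
    Measure.restrict_eq_self_of_ae_mem (by
      filter_upwards [compl_mem_ae_iff.2 hvol] with z hz using not_not.1 hz)
  set F := zeroExt f with hF
  have hinf : Infinite Ω := by
    obtain ⟨z, hz⟩ := hΩ
    exact (infinite_of_mem_nhds z (Ω.isOpen.mem_nhds hz)).to_subtype
  -- The condition `φ α = 0` costs at most one dimension, and one more is needed to exceed the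
  -- dimension of `A^p(Ω)`.
  set N := Module.finrank ℂ (bergmanSubmodule p Ω) + 2 with hN
  set c : Fin N → Ω := fun i => Infinite.natEmbedding Ω i with hc
  have hcinj : Function.Injective fun i => (c i : ℂ) :=
    Subtype.val_injective.comp ((Infinite.natEmbedding Ω).injective.comp Fin.val_injective)
  set φ : (Fin N → ℂ) →ₗ[ℂ] ℂ := Fintype.linearCombination ℂ fun i => F (c i) with hφ
  set L : (Fin N → ℂ) →ₗ[ℂ] (Ω → ℂ) :=
    Fintype.linearCombination ℂ fun i (z : Ω) => dslope F (c i) z with hL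
  have hφ_apply (α : Fin N → ℂ) : φ α = ∑ i, α i * F (c i) := by
    simp [hφ, Fintype.linearCombination_apply]
  have hL_apply (α : Fin N → ℂ) : L α = fun z : Ω => ∑ i, α i * dslope F (c i) z := by
    ext z
    simp [hL, Fintype.linearCombination_apply, Finset.sum_apply]
  have hLmem : ∀ α ∈ φ.ker, L α ∈ bergmanSubmodule p Ω := by
    intro α hα
    rw [LinearMap.mem_ker, hφ_apply] at hα
    rw [hL_apply]
    exact sum_dslope_mem_bergmanSubmodule hp1 hp hf (fun i => (c i).2) α hα
  have hdim : Module.finrank ℂ (bergmanSubmodule p Ω) < Module.finrank ℂ φ.ker := by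
    have h1 := φ.finrank_range_add_finrank_ker
    have h2 : Module.finrank ℂ φ.range ≤ 1 := by simpa using Submodule.finrank_le φ.range
    rw [Module.finrank_fin_fun] at h1
    omega
  obtain ⟨⟨α, hαφ⟩, hαL, hα0⟩ := Submodule.exists_mem_ne_zero_of_ne_bot
    (LinearMap.ker_ne_bot_of_finrank_lt (f := L.restrict hLmem) hdim)
  have hα0' : α ≠ 0 := fun h => hα0 (Subtype.ext h)
  have hLα : L α = 0 := congrArg Subtype.val (LinearMap.mem_ker.1 hαL)
  -- The relation reads `f(z) ∑ α_i / (z - c_i) = ∑ α_i f(c_i) / (z - c_i)`. Clearing denominators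
  -- gives `f B = A`, with `B ≠ 0` because `α ≠ 0`.
  obtain ⟨B, hB0, hB⟩ := exists_polynomial_eval_eq_sum_inv_sub _ hcinj α
  obtain ⟨A, -, hA⟩ := exists_polynomial_eval_eq_sum_inv_sub _ hcinj fun i => α i * F (c i)
  set S : Finset ℂ := B.roots.toFinset ∪ Finset.univ.image fun i => (c i : ℂ) with hS
  have hSB {z : ℂ} (hz : z ∉ S) : B.eval z ≠ 0 := by
    intro h
    exact hz (Finset.mem_union_left _
      (Multiset.mem_toFinset.2 ((Polynomial.mem_roots (hB0 hα0')).2 h)))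
  have hSc {z : ℂ} (hz : z ∉ S) : z ∉ range fun i => (c i : ℂ) := by
    rintro ⟨i, rfl⟩
    exact hz (Finset.mem_union_right _ (Finset.mem_image_of_mem _ (Finset.mem_univ i)))
  have hFAB {z : ℂ} (hz : z ∈ Ω) (hzS : z ∉ S) : F z = A.eval z / B.eval z := by
    rw [eq_div_iff (hSB hzS), hA z (hSc hzS), hB z (hSc hzS)]
    have h1 := congrFun hLα ⟨z, hz⟩
    rw [hL_apply] at h1
    have h2 : ∑ i, α i * dslope F (c i) z =
        F z * ∑ i, α i * (z - c i)⁻¹ - ∑ i, α i * F (c i) * (z - c i)⁻¹ := by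
      rw [Finset.mul_sum, ← Finset.sum_sub_distrib]
      refine Finset.sum_congr rfl fun i _ => ?_
      have hzi : z ≠ c i := fun h => hSc hzS ⟨i, h.symm⟩
      have hz0 : z - c i ≠ 0 := sub_ne_zero.2 hzi
      rw [dslope_of_ne _ hzi, slope_def_field]
      field_simp
    have h3 : F z * ∑ i, α i * (z - c i)⁻¹ - ∑ i, α i * F (c i) * (z - c i)⁻¹ = 0 := h2 ▸ h1
    linear_combination (∏ j, (z - (c j : ℂ))) * h3
  have hae : F =ᵐ[volume] fun z => A.eval z / B.eval z := by
    have hSnull : volume (S : Set ℂ) = 0 := S.finite_toSet.measure_zero volume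
    filter_upwards [compl_mem_ae_iff.2 hSnull, compl_mem_ae_iff.2 hvol] with z hzS hz
    exact hFAB (not_not.1 hz) hzS
  have hfm := hf.2
  rw [hrestrict] at hfm
  have hzero := eq_zero_of_memLp_of_two_le (S := S) (f := fun z => A.eval z / B.eval z) hp2 hp
    (fun z hz => (A.differentiableAt.div B.differentiableAt (hSB hz)).differentiableWithinAt)
    ((memLp_congr_ae hae).1 hfm)
  have hF0 : F =ᵐ[volume.restrict (Ω : Set ℂ)] 0 := by
    rw [hrestrict]
    have hSnull : volume (S : Set ℂ) = 0 := S.finite_toSet.measure_zero volume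
    filter_upwards [hae, compl_mem_ae_iff.2 hSnull] with z hz hzS
    rw [hz, hzero z hzS, Pi.zero_apply]
  have hEq : EqOn F 0 Ω :=
    Measure.eqOn_open_of_ae_eq hF0 Ω.isOpen hf.1.continuousOn continuousOn_const
  ext z
  rw [← zeroExt_apply f z]
  exact hEq z.2

/-- For `2 ≤ p < ∞`, the space `A^p` of a domain is zero or infinite dimensional. -/
theorem eq_zero_or_not_finiteDimensional (hΩ : IsConnected (Ω : Set ℂ)) (hp2 : 2 ≤ p) (hp : p ≠ ∞) :
    (∀ f : BergmanSpace p Ω, f = 0) ∨ ¬ FiniteDimensional ℂ (BergmanSpace p Ω) := by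
  by_contra! h
  obtain ⟨⟨f, hf⟩, hfin⟩ := h
  have hfin' : FiniteDimensional ℂ (bergmanSubmodule p Ω) := hfin
  by_cases hvol : volume (Ω : Set ℂ)ᶜ = 0
  · exact hf (Subtype.ext (eq_zero_of_finiteDimensional_of_volume_compl hΩ.nonempty hp2 hp hvol f.2))
  · have hnt : Nontrivial (bergmanSubmodule p Ω) := ⟨f, 0, hf⟩
    obtain ⟨F, hF, ⟨C, hC⟩, hnc⟩ := exists_bounded_nonconstant hΩ.nonempty hvol
    exact hnc (exists_eqOn_const_of_finiteDimensional (p := p) hΩ hF hC)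

end DividedDifferences

theorem mainTheorem1 (p : ℝ≥0∞) [Fact (1 ≤ p)] (hp : p ≠ ∞) :
    (p < 2 → ∀ k : ℕ, ∃ Ω : Opens ℂ, IsConnected (Ω : Set ℂ) ∧
      Module.rank ℂ (BergmanSpace p Ω) = k) ∧
    (1 < p → p < 2 → ∀ (k : ℕ) (a : Fin (k + 1) → ℂ), Function.Injective a →
      IsConnected (puncturedPlane a : Set ℂ) ∧
      Module.rank ℂ (BergmanSpace p (puncturedPlane a)) = k ∧
      ∃ b : Module.Basis (Fin k) ℂ (BergmanSpace p (puncturedPlane a)),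
        ∀ (j : Fin k) (z : puncturedPlane a),
          b j z = 1 / ((z : ℂ) - a 0) - 1 / ((z : ℂ) - a j.succ)) ∧
    (2 ≤ p → ∀ Ω : Opens ℂ, IsConnected (Ω : Set ℂ) →
      (∀ f : BergmanSpace p Ω, f = 0) ∨
      (CompleteSpace (BergmanSpace p Ω) ∧ ¬ FiniteDimensional ℂ (BergmanSpace p Ω))) := by
  refine ⟨fun hp2 k => exists_isConnected_rank_bergmanSpace_eq Fact.out hp2 k,
    fun hp1 hp2 k a ha => ⟨isConnected_puncturedPlane a,
      rank_bergmanSpace_puncturedPlane ha hp1 hp2,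
      exists_basis_bergmanSpace_puncturedPlane ha hp1 hp2⟩,
    fun hp2 Ω hΩ => ?_⟩
  exact (eq_zero_or_not_finiteDimensional hΩ hp2 hp).imp_right
    fun h => ⟨BergmanSpace.completeSpace hp, h⟩
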